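/- Let $\alpha,\beta\ge 0$ and let $F=F^{(\alpha,\beta)}_{dK}:(0,\infty)^2\to(0,\infty)^2$ be the discrete KdV lattice map $$F(x,u)=\left(\frac{u(1+\beta xu)}{1+\alpha xu},\ \frac{x(1+\alpha xu)}{1+\beta xu}\right)=:\left(F^{(1)}(x,u),F^{(2)}(x,u)\right).$$ Let $\mathcal X^*$ be the set of configurations $x=(x_n)_{n\in\mathbb Z}\in(0,\infty)^{\mathbb Z}$ for which there is exactly one $(x^t_n,u^t_n)_{n,t\in\mathbb Z}$ with entries in $(0,\infty)$ such that $F(x^t_n,u^t_{n-1})=(x^{t+1}_n,u^t_n)$ and $x^0_n=x_n$ for all $n,t\in\mathbb Z$. Let $\mathcal X^{\exists!}$ be the set of $x\in(0,\infty)^{\mathbb Z}$ for which there is exactly one $(u_n)_{n\in\mathbb Z}\in(0,\infty)^{\mathbb Z}$ with $F^{(2)}(x_n,u_{n-1})=u_n$ for all $n\in\mathbb Z$. The one time-step dynamics $\mathcal T=\mathcal T^{(\alpha,\beta)}_{dK}$ is defined on $\mathcal X^*\cup\mathcal X^{\exists!}$ by $\mathcal T(x)_n=x^1_n$ for $x\in\mathcal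 X^*$ and $\mathcal T(x)_n=F^{(1)}(x_n,u_{n-1})$ for $x\in\mathcal X^{\exists!}$ (the two agree on $\mathcal X^*\cap\mathcal X^{\exists!}$). For $\lambda,c_1,c_2>0$ let $\mathrm{GIG}(\lambda,c_1,c_2)$ be the probability measure on $(0,\infty)$ with density proportional to $x^{-\lambda-1}e^{-c_1x-c_2x^{-1}}$, and for $\lambda,c>0$ let $\mathrm{IG}(\lambda,c)$ be the one with density proportional to $x^{-\lambda-1}e^{-cx^{-1}}$. For a Borel probability measure $\mu$ on $(0,\infty)$ let $\mu^{\mathbb Z}$ be the product measure on $(0,\infty)^{\mathbb Z}$. Then $\mathcal T$ is defined $\mu^{\mathbb Z}$-almost everywhere, indeed $\mu^{\mathbb Z}(\mathcal X^*)=1$, and $\mathcal T\mu^{\mathbb Z}=\mu^{\mathbb Z}$ (i.e. $\mathcal T$ is $\mu^{\mathbb Z}$-measurable and the image of $\mu^{\mathbb Z}$ under $\mathcal T$ is $\mu^{\mathbb Z}$) for the following measures $\mu$. (a) Suppose $\alpha=\beta$. Any Borel probability measure $\mu$ on $(0,\infty)$. (b) Suppose $\alpha>0$, $\beta=0$. The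 measure $\mu=\mathrm{GIG}(\lambda,c\alpha,c)$ for any parameters $\lambda,c>0$ such that $2\int\log x\,\mu(dx)<-\log\alpha$. (c) Suppose $\alpha=0$, $\beta>0$. The measure $\mu=\mathrm{IG}(\lambda,c)$ for any parameters $\lambda,c>0$ such that $2\int\log x\,\mu(dx)<-\log\beta$. In this case moreover $\mu^{\mathbb Z}(\mathcal X^{\exists!})=1$. -/

import Mathlib

open MeasureTheory
open scoped NNReal ENNReal

/-! ### Homogeneous lattice models with a single lattice map `F` -/

namespace Lattice

variable {X U : Type*}

/-- `(x, u)` solves the initial value problem with initial condition `x₀` (the time index comes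
first): `F (x t n, u t (n - 1)) = (x (t + 1) n, u t n)` for all `n, t ∈ ℤ`, and `x 0 = x₀`. -/
def IsSolution (F : X × U → X × U) (x₀ : ℤ → X) (x : ℤ → ℤ → X) (u : ℤ → ℤ → U) : Prop :=
  (∀ n t : ℤ, F (x t n, u t (n - 1)) = (x (t + 1) n, u t n)) ∧ ∀ n : ℤ, x 0 n = x₀ n

/-- The configurations for which the initial value problem has exactly one solution. -/
def uniqueSolution (F : X × U → X × U) : Set (ℤ → X) :=
  {x₀ | ∃! s : (ℤ → ℤ → X) × (ℤ → ℤ → U), IsSolution F x₀ s.1 s.2}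

/-- `u` is a carrier for one time step from `x₀`: `F⁽²⁾ (x₀ n, u (n - 1)) = u n` for all `n`. -/
def IsCarrier (F : X × U → X × U) (x₀ : ℤ → X) (u : ℤ → U) : Prop :=
  ∀ n : ℤ, (F (x₀ n, u (n - 1))).2 = u n

/-- The configurations for which there is exactly one carrier for one time step. -/
def uniqueCarrier (F : X × U → X × U) : Set (ℤ → X) :=
  {x₀ | ∃! u : ℤ → U, IsCarrier F x₀ u}

open Classical in
/-- The one time-step dynamics `𝒯`. On `uniqueSolution F` it sends `x₀` to the time-one
configuration `x 1` of the solution of the initial value problem; on `uniqueCarrier F` it sends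
`x₀` to `F⁽¹⁾ (x₀ n, u (n - 1))`, with `u` the carrier. The two prescriptions agree on the
intersection, see `dynamics_of_carrier`. Outside the union of the two sets `𝒯` is undefined, and the
value is irrelevant. -/
noncomputable def dynamics (F : X × U → X × U) (x₀ : ℤ → X) : ℤ → X :=
  if h : x₀ ∈ uniqueSolution F then h.choose.1 1
  else if h : x₀ ∈ uniqueCarrier F then fun n => (F (x₀ n, h.choose (n - 1))).1
  else x₀

theorem dynamics_of_solution {F : X × U → X × U} {x₀ : ℤ → X} (h : x₀ ∈ uniqueSolution F)
    {x : ℤ → ℤ → X} {u : ℤ → ℤ → U} (hs : IsSolution F x₀ x u) : dynamics F x₀ = x 1 := by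
  have h1 := h.choose_spec.2 (x, u) hs
  unfold dynamics
  rw [dif_pos h]
  exact congrArg (fun s : (ℤ → ℤ → X) × (ℤ → ℤ → U) => s.1 1) h1.symm

theorem dynamics_of_carrier {F : X × U → X × U} {x₀ : ℤ → X} (h : x₀ ∈ uniqueCarrier F)
    {u : ℤ → U} (hu : IsCarrier F x₀ u) :
    dynamics F x₀ = fun n => (F (x₀ n, u (n - 1))).1 := by
  by_cases hx : x₀ ∈ uniqueSolution F
  · obtain ⟨⟨x, v⟩, hs, -⟩ := id hx
    have hv : IsCarrier F x₀ (v 0) := fun n => by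
      rw [← hs.2 n, hs.1 n 0]
    have huv : v 0 = u := h.unique hv hu
    rw [dynamics_of_solution hx hs]
    funext n
    rw [← huv, ← hs.2 n, hs.1 n 0, zero_add]
  · unfold dynamics
    rw [dif_neg hx, dif_pos h, h.unique h.choose_spec.1 hu]

/-- `P` is carried by `D` (for us a part of the set where `𝒯` is defined), and `𝒯 P = P`. -/
def IsInvariantOn [MeasurableSpace X] (F : X × U → X × U) (D : Set (ℤ → X))
    (P : Measure (ℤ → X)) : Prop :=
  (∀ᵐ x ∂P, x ∈ D) ∧ AEMeasurable (dynamics F) P ∧ P.map (dynamics F) = P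

end Lattice

/-! ### The discrete KdV lattice map -/

namespace DKdV

/-- The state space `(0, ∞)`. -/
abbrev PosReal : Type := {x : ℝ // 0 < x}

/-- The lattice map
`(x, u) ↦ (u (1 + β x u) / (1 + α x u), x (1 + α x u) / (1 + β x u))` of `(0, ∞)²`. -/
noncomputable def map (α β : ℝ≥0) (p : PosReal × PosReal) : PosReal × PosReal :=
  have hx : 0 < (p.1 : ℝ) := p.1.2
  have hu : 0 < (p.2 : ℝ) := p.2.2
  (⟨p.2 * (1 + β * p.1 * p.2) / (1 + α * p.1 * p.2), by positivity⟩,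
    ⟨p.1 * (1 + α * p.1 * p.2) / (1 + β * p.1 * p.2), by positivity⟩)

/-- The measure on `(0, ∞)` whose Lebesgue density is `w`. -/
noncomputable def densityMeasure (w : ℝ → ℝ) : Measure PosReal :=
  ((volume : Measure ℝ).comap Subtype.val).withDensity fun x => ENNReal.ofReal (w x)

/-- The probability measure on `(0, ∞)` whose Lebesgue density is `w / Z`, where `Z` is the
normalizing constant. -/
noncomputable def normalizedDensity (w : ℝ → ℝ) : Measure PosReal :=
  (densityMeasure w Set.univ)⁻¹ • densityMeasure w

/-- The generalized inverse Gaussian distribution `GIG(l, c₁, c₂)`, with density proportional to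
`x ^ (-l - 1) * exp (-c₁ x - c₂ / x)` on `(0, ∞)`. -/
noncomputable def gig (l c₁ c₂ : ℝ) : Measure PosReal :=
  normalizedDensity fun x => x ^ (-l - 1) * Real.exp (-c₁ * x - c₂ * x⁻¹)

/-- The inverse gamma distribution `IG(l, c)`, with density proportional to
`x ^ (-l - 1) * exp (-c / x)` on `(0, ∞)`. -/
noncomputable def inverseGamma (l c : ℝ) : Measure PosReal :=
  normalizedDensity fun x => x ^ (-l - 1) * Real.exp (-c * x⁻¹)

theorem inverseGamma_eq_gig (l c : ℝ) : inverseGamma l c = gig l 0 c := by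
  simp [inverseGamma, gig]

theorem densityMeasure_univ (w : ℝ → ℝ) :
    densityMeasure w Set.univ = ∫⁻ x in Set.Ioi (0 : ℝ), ENNReal.ofReal (w x) := by
  rw [densityMeasure, withDensity_apply _ MeasurableSet.univ, Measure.restrict_univ]
  exact lintegral_subtype_comap (measurableSet_Ioi : MeasurableSet (Set.Ioi (0 : ℝ)))
    fun x => ENNReal.ofReal (w x)

theorem integrableOn_inverseGamma {l c : ℝ} (hl : 0 < l) (hc : 0 < c) :
    IntegrableOn (fun x : ℝ => x ^ (-l - 1) * Real.exp (-c * x⁻¹)) (Set.Ioi 0) := by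
  have h1 : IntegrableOn (fun y : ℝ => y ^ (l - 1) * Real.exp (-c * y ^ (1 : ℝ))) (Set.Ioi 0) :=
    integrableOn_rpow_mul_exp_neg_mul_rpow (by linarith) one_pos hc
  have h2 := (integrableOn_Ioi_comp_rpow_iff' _ (p := (-1 : ℝ)) (by norm_num)).2 h1
  refine h2.congr_fun (fun x hx => ?_) measurableSet_Ioi
  have hx : 0 < x := hx
  simp only [Real.rpow_one, smul_eq_mul, Real.rpow_neg_one]
  rw [← mul_assoc, ← Real.rpow_neg_one x, ← Real.rpow_mul hx.le, ← Real.rpow_add hx]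
  congr 2
  ring

theorem integrableOn_gig {l c₁ c₂ : ℝ} (hl : 0 < l) (hc₁ : 0 ≤ c₁) (hc₂ : 0 < c₂) :
    IntegrableOn (fun x : ℝ => x ^ (-l - 1) * Real.exp (-c₁ * x - c₂ * x⁻¹)) (Set.Ioi 0) := by
  refine (integrableOn_inverseGamma hl hc₂).mono' (by fun_prop) ?_
  refine (ae_restrict_iff' measurableSet_Ioi).2 (Filter.Eventually.of_forall fun x hx => ?_)
  have hx : 0 < x := hx
  rw [Real.norm_of_nonneg (by positivity)]
  gcongr
  nlinarith

theorem isProbabilityMeasure_gig {l c₁ c₂ : ℝ} (hl : 0 < l) (hc₁ : 0 ≤ c₁) (hc₂ : 0 < c₂) :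
    IsProbabilityMeasure (gig l c₁ c₂) := by
  refine ⟨?_⟩
  rw [gig, normalizedDensity, Measure.smul_apply, smul_eq_mul]
  refine ENNReal.inv_mul_cancel ?_ ?_ <;> rw [densityMeasure_univ]
  · rw [← pos_iff_ne_zero, setLIntegral_pos_iff (by fun_prop)]
    refine lt_of_lt_of_le (b := volume (Set.Ioi (0 : ℝ))) (by simp) (measure_mono fun x hx => ?_)
    have hx' : 0 < x := hx
    refine ⟨?_, hx⟩
    rw [Function.mem_support, ← pos_iff_ne_zero, ENNReal.ofReal_pos]
    positivity
  · exact (integrableOn_gig hl hc₁ hc₂).lintegral_lt_top.ne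

theorem isProbabilityMeasure_inverseGamma {l c : ℝ} (hl : 0 < l) (hc : 0 < c) :
    IsProbabilityMeasure (inverseGamma l c) := by
  rw [inverseGamma_eq_gig]
  exact isProbabilityMeasure_gig hl le_rfl hc

end DKdV

/-- The law `μ^ℤ` of an i.i.d. configuration with marginal the probability measure `μ`. -/
noncomputable def iidMeasure {X : Type*} [MeasurableSpace X] (μ : Measure X) : Measure (ℤ → X) :=
  Measure.infinitePi fun _ : ℤ => μ

/-! The argument combines an invariant product law for one site with a carrier that forgets its
starting value.

Invariant laws. `map α β` conserves the product `x u` and, in logarithmic coordinates, is a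
shear-type map preserving Lebesgue measure. Hence `dx/x ⊗ du/u` is invariant, and so is any density
with respect to it that is a function of conserved quantities. If `α = 0`, both `x u` and `1/x + β u
+ 1/u` are conserved, which makes `IG ⊗ GIG` invariant; swapping the coordinates gives the case `β =
0`.

From one site to the line. Given `F`-invariance of `μ ⊗ ν`, letting the carrier pass through
finitely many sites preserves `μ^ℤ ⊗ ν`. If the carrier started at `-N` converges as `N → ∞` to a
limit independent of its starting value, bounded continuous test functions give invariance of `μ^ℤ`
under the limiting output map (`map_output_iidMeasure`).

Convergence. The condition on the logarithm says that `γ x²` has negative mean logarithm, with `γ`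
the nonzero parameter, so by the strong law its products to the left decay exponentially. If `β = 0`
the carrier equation is affine and its series solution converges; if `α = 0` the carrier map
contracts ratios. If `α = β` the map is the swap.

Uniqueness. If `β = 0` carriers need not be unique, but only the minimal one leaves an output that
has a carrier itself (`isSelection_minimalCarrier`). This fixes all future times. Since `F` is an
involution, the past is the future of the reflected configuration, whose law is the same. -/

namespace Lattice

/-! ### Solutions for all times from a selected carrier; finite runs of the carrier. -/

section Deterministic

variable {X U : Type*} {F : X × U → X × U}

/-- An involution can be read in both directions, so reflecting space and time maps solutions to
solutions. The carrier lives between sites and between times, hence its extra shift by one in each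
index. -/
theorem IsSolution.reverse (hF : Function.Involutive F) {x₀ : ℤ → X} {x : ℤ → ℤ → X}
    {u : ℤ → ℤ → U} (h : IsSolution F x₀ x u) :
    IsSolution F (fun n => x₀ (-n)) (fun t n => x (-t) (-n)) (fun t n => u (-t - 1) (-n - 1)) := by
  refine ⟨fun n t => ?_, fun n => by simpa using h.2 (-n)⟩
  have h1 := h.1 (-n) (-t - 1)
  rw [show -t - 1 + 1 = -t by ring] at h1
  have h2 := hF (x (-t - 1) (-n), u (-t - 1) (-n - 1))
  rw [h1] at h2
  simpa only [show -(n - 1) - 1 = -n by ring, show -(t + 1) = -t - 1 by ring] using h2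

/-- The configuration left behind by the carrier `C x`. -/
def output (F : X × U → X × U) (C : (ℤ → X) → ℤ → U) (x : ℤ → X) : ℤ → X :=
  fun n => (F (x n, C x (n - 1))).1

/-- `C` selects, for configurations in `G`, the only carrier whose output has a carrier itself. -/
structure IsSelection (F : X × U → X × U) (G : Set (ℤ → X)) (C : (ℤ → X) → ℤ → U) : Prop where
  isCarrier : ∀ x ∈ G, IsCarrier F x (C x)
  eq_of_isCarrier : ∀ x ∈ G, ∀ u v : ℤ → U, IsCarrier F x u →
    IsCarrier F (fun n => (F (x n, u (n - 1))).1) v → u = C x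

variable {G : Set (ℤ → X)} {C : (ℤ → X) → ℤ → U}

theorem IsSelection.map_eq (hC : IsSelection F G C) {x : ℤ → X} (hx : x ∈ G) (n : ℤ) :
    F (x n, C x (n - 1)) = (output F C x n, C x n) :=
  Prod.ext rfl (hC.isCarrier x hx n)

/-- In a solution, `u k` is a carrier of `x k` whose output `x (k + 1)` has the carrier `u (k + 1)`.
The selection property therefore forces `u k`, and with it `x (k + 1)`. -/
theorem IsSelection.forward_unique (hC : IsSelection F G C) {x₀ : ℤ → X}
    (hx₀ : ∀ k : ℕ, (output F C)^[k] x₀ ∈ G) {x : ℤ → ℤ → X} {u : ℤ → ℤ → U}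
    (h : IsSolution F x₀ x u) (k : ℕ) :
    x k = (output F C)^[k] x₀ ∧ u k = C ((output F C)^[k] x₀) := by
  have key : ∀ k : ℕ, x k = (output F C)^[k] x₀ → u k = C ((output F C)^[k] x₀) := by
    intro k hk
    refine hC.eq_of_isCarrier _ (hx₀ k) _ (u (k + 1)) (fun n => ?_) (fun n => ?_)
    · rw [← hk, h.1]
    · simp only [← hk, h.1]
  induction k with
  | zero => exact ⟨funext h.2, key 0 (funext h.2)⟩
  | succ k ih =>
    have h1 : x (k + 1 : ℕ) = (output F C)^[k + 1] x₀ := by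
      funext n
      rw [Function.iterate_succ_apply', output, ← ih.2, ← ih.1, h.1]
      simp
    exact ⟨h1, key _ h1⟩

theorem IsSelection.exists_solution (hC : IsSelection F G C) (hF : Function.Involutive F)
    {x₀ : ℤ → X} (hx₀ : ∀ k : ℕ, (output F C)^[k] x₀ ∈ G)
    (hx₀' : ∀ k : ℕ, (output F C)^[k] (fun n => x₀ (-n)) ∈ G) :
    ∃ (x : ℤ → ℤ → X) (u : ℤ → ℤ → U), IsSolution F x₀ x u := by
  set z : ℕ → ℤ → X := fun k => (output F C)^[k] x₀ with hz
  set z' : ℕ → ℤ → X := fun k => (output F C)^[k] (fun n => x₀ (-n)) with hz'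
  have hzs : ∀ k n, z (k + 1) n = output F C (z k) n := fun k n => by
    simp only [hz, Function.iterate_succ_apply']
  have hzs' : ∀ k n, z' (k + 1) n = output F C (z' k) n := fun k n => by
    simp only [hz', Function.iterate_succ_apply']
  refine ⟨fun t n => if 0 ≤ t then z t.toNat n else z' (-t).toNat (-n),
    fun t n => if 0 ≤ t then C (z t.toNat) n else C (z' (-t - 1).toNat) (-n - 1), ?_, ?_⟩
  · intro n t
    rcases lt_or_ge t 0 with ht | ht
    · obtain ⟨k, rfl⟩ : ∃ k : ℕ, t = -k - 1 := ⟨(-t - 1).toNat, by omega⟩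
      have h1 : ¬ (0 : ℤ) ≤ -(k : ℤ) - 1 := by omega
      have h2 : (-(-(k : ℤ) - 1)).toNat = k + 1 := by omega
      have h3 : (-(-(k : ℤ) - 1) - 1).toNat = k := by omega
      simp only [if_neg h1, h2, h3]
      -- The two halves are glued at time `0`, where both give `x₀`.
      have h4 : (if 0 ≤ -(k : ℤ) - 1 + 1 then z (-(k : ℤ) - 1 + 1).toNat n
          else z' (-(-(k : ℤ) - 1 + 1)).toNat (-n)) = z' k (-n) := by
        rcases Nat.eq_zero_or_pos k with rfl | hk
        · simp [hz, hz']
        · rw [if_neg (by omega)]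
          congr 2
          omega
      rw [h4, show -(n - 1) - 1 = -n by ring, hzs', ← hC.map_eq (hx₀' k) (-n)]
      exact hF _
    · obtain ⟨k, rfl⟩ := Int.eq_ofNat_of_zero_le ht
      have h2 : ((k : ℤ) + 1).toNat = k + 1 := by omega
      simp only [if_pos ht, if_pos (show (0 : ℤ) ≤ k + 1 by omega), h2, Int.toNat_natCast]
      rw [hzs, hC.map_eq (hx₀ k)]
  · intro n
    simp [hz]

theorem IsSelection.mem_uniqueSolution (hC : IsSelection F G C) (hF : Function.Involutive F)
    {x₀ : ℤ → X} (hx₀ : ∀ k : ℕ, (output F C)^[k] x₀ ∈ G)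
    (hx₀' : ∀ k : ℕ, (output F C)^[k] (fun n => x₀ (-n)) ∈ G) :
    x₀ ∈ uniqueSolution F ∧ dynamics F x₀ = output F C x₀ := by
  obtain ⟨x, u, h⟩ := hC.exists_solution hF hx₀ hx₀'
  have hmem : x₀ ∈ uniqueSolution F := by
    refine ⟨(x, u), h, ?_⟩
    rintro ⟨y, v⟩ h'
    have hp := fun k => (hC.forward_unique hx₀ h' k).1.trans (hC.forward_unique hx₀ h k).1.symm
    have hq := fun k => (hC.forward_unique hx₀ h' k).2.trans (hC.forward_unique hx₀ h k).2.symm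
    have hp' := fun k => (hC.forward_unique hx₀' (h'.reverse hF) k).1.trans
      (hC.forward_unique hx₀' (h.reverse hF) k).1.symm
    have hq' := fun k => (hC.forward_unique hx₀' (h'.reverse hF) k).2.trans
      (hC.forward_unique hx₀' (h.reverse hF) k).2.symm
    refine Prod.ext (funext fun t => ?_) (funext fun t => ?_)
    · rcases lt_or_ge t 0 with ht | ht
      · obtain ⟨k, rfl⟩ : ∃ k : ℕ, t = -k := ⟨(-t).toNat, by omega⟩
        funext n
        simpa using congrFun (hp' k) (-n)
      · obtain ⟨k, rfl⟩ := Int.eq_ofNat_of_zero_le ht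
        exact hp k
    · rcases lt_or_ge t 0 with ht | ht
      · obtain ⟨k, rfl⟩ : ∃ k : ℕ, t = -k - 1 := ⟨(-t - 1).toNat, by omega⟩
        funext n
        simpa using congrFun (hq' k) (-n - 1)
      · obtain ⟨k, rfl⟩ := Int.eq_ofNat_of_zero_le ht
        exact hq k
  refine ⟨hmem, ?_⟩
  rw [dynamics_of_solution hmem h]
  exact (hC.forward_unique hx₀ h 1).1

/-- The carrier at position `a + k` when it is started from the value `w` at position `a`. -/
def carrierFrom (F : X × U → X × U) (x : ℤ → X) (w : U) (a : ℤ) : ℕ → U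
  | 0 => w
  | k + 1 => (F (x (a + k + 1), carrierFrom F x w a k)).2

/-- The carrier passes through position `n`. -/
def step (F : X × U → X × U) (n : ℤ) (s : (ℤ → X) × U) : (ℤ → X) × U :=
  (Function.update s.1 n (F (s.1 n, s.2)).1, (F (s.1 n, s.2)).2)

/-- The carrier passes through the positions `a + 1, …, a + k`. -/
def run (F : X × U → X × U) (a : ℤ) : ℕ → (ℤ → X) × U → (ℤ → X) × U
  | 0 => id
  | k + 1 => step F (a + k + 1) ∘ run F a k

theorem run_apply (F : X × U → X × U) (a : ℤ) (x : ℤ → X) (w : U) (k : ℕ) :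
    (run F a k (x, w)).2 = carrierFrom F x w a k ∧ ∀ n, (run F a k (x, w)).1 n =
      if a < n ∧ n ≤ a + k then (F (x n, carrierFrom F x w a (n - 1 - a).toNat)).1 else x n := by
  induction k with
  | zero =>
    refine ⟨rfl, fun n => ?_⟩
    rw [if_neg (by omega)]
    rfl
  | succ k ih =>
    have h0 : (run F a k (x, w)).1 (a + k + 1) = x (a + k + 1) := by
      rw [ih.2, if_neg (by omega)]
    refine ⟨?_, fun n => ?_⟩
    · simp only [run, Function.comp_apply, step, carrierFrom, h0, ih.1]
    · simp only [run, Function.comp_apply, step, h0, ih.1]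
      rcases eq_or_ne n (a + k + 1) with rfl | hn
      · rw [Function.update_self, if_pos (by push_cast; omega)]
        congr 4
        omega
      · rw [Function.update_of_ne hn, ih.2]
        refine if_congr ?_ rfl rfl
        push_cast
        omega

end Deterministic

/-! ### Finite runs preserve the product measure. -/

section Measure

variable {X U : Type*} [MeasurableSpace X] [MeasurableSpace U] {F : X × U → X × U}

theorem measurePreserving_update_iidMeasure (μ : Measure X) [IsProbabilityMeasure μ] (n : ℤ) :
    MeasurePreserving (fun p : (ℤ → X) × X => Function.update p.1 n p.2)
      ((iidMeasure μ).prod μ) (iidMeasure μ) := by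
  have hm : Measurable (fun p : (ℤ → X) × X => Function.update p.1 n p.2) := by
    refine measurable_pi_lambda _ fun m => ?_
    rcases eq_or_ne m n with rfl | h
    · simpa using measurable_snd
    · simpa [Function.update_of_ne h, Function.comp_def] using
        (measurable_pi_apply m).comp measurable_fst
  refine ⟨hm, Measure.eq_infinitePi _ fun s t ht => ?_⟩
  have hs : MeasurableSet (Set.pi (s : Set ℤ) t) := .pi s.countable_toSet fun i _ => ht i
  rw [Measure.map_apply hm hs]
  have hpre : (fun p : (ℤ → X) × X => Function.update p.1 n p.2) ⁻¹' Set.pi (s : Set ℤ) t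
      = Set.pi ((s.erase n : Finset ℤ) : Set ℤ) t ×ˢ (if n ∈ s then t n else Set.univ) := by
    ext ⟨x, a⟩
    simp only [Set.mem_preimage, Set.mem_pi, Set.mem_prod, Finset.mem_coe, Finset.mem_erase]
    constructor
    · intro h
      refine ⟨fun i hi => by simpa [Function.update_of_ne hi.1] using h i hi.2, ?_⟩
      split_ifs with hn
      · simpa using h n hn
      · trivial
    · rintro ⟨h1, h2⟩ i hi
      rcases eq_or_ne i n with rfl | h
      · simpa [hi] using h2
      · simpa [Function.update_of_ne h] using h1 i ⟨h, hi⟩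
  rw [hpre, Measure.prod_prod, iidMeasure, Measure.infinitePi_pi _ (fun i _ => ht i)]
  split_ifs with hn
  · exact Finset.prod_erase_mul s (fun i => μ (t i)) hn
  · rw [Finset.erase_eq_of_notMem hn, measure_univ, mul_one]

instance (μ : Measure X) [IsProbabilityMeasure μ] : IsProbabilityMeasure (iidMeasure μ) := by
  unfold iidMeasure
  infer_instance

theorem measurePreserving_reverse_iidMeasure (μ : Measure X) [IsProbabilityMeasure μ] :
    MeasurePreserving (fun (x : ℤ → X) n => x (-n)) (iidMeasure μ) (iidMeasure μ) := by
  have hm : Measurable (fun (x : ℤ → X) n => x (-n)) :=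
    measurable_pi_lambda _ fun n => measurable_pi_apply (-n)
  refine ⟨hm, Measure.eq_infinitePi _ fun s t ht => ?_⟩
  rw [Measure.map_apply hm (.pi s.countable_toSet fun i _ => ht i)]
  have hpre : (fun (x : ℤ → X) n => x (-n)) ⁻¹' Set.pi (s : Set ℤ) t
      = Set.pi ((s.map (Equiv.neg ℤ).toEmbedding : Finset ℤ) : Set ℤ) (fun i => t (-i)) := by
    ext x
    simp only [Set.mem_preimage, Set.mem_pi, Finset.mem_coe, Finset.mem_map_equiv]
    exact (Equiv.neg ℤ).forall_congr fun i => by simp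
  rw [hpre, iidMeasure, Measure.infinitePi_pi _ (fun i _ => ht (-i))]
  simp

theorem measurePreserving_step {μ : Measure X} {ν : Measure U} [IsProbabilityMeasure μ]
    [IsProbabilityMeasure ν] (hF : MeasurePreserving F (μ.prod ν) (μ.prod ν)) (n : ℤ) :
    MeasurePreserving (step F n) ((iidMeasure μ).prod ν) ((iidMeasure μ).prod ν) := by
  have hR : MeasurePreserving
      (fun p : (ℤ → X) × (X × U) => (Function.update p.1 n p.2.1, p.2.2))
      ((iidMeasure μ).prod (μ.prod ν)) ((iidMeasure μ).prod ν) :=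
    ((measurePreserving_update_iidMeasure μ n).prod (MeasurePreserving.id ν)).comp
      (measurePreserving_prodAssoc (iidMeasure μ) μ ν).symm
  have hm : Measurable (step F n) := by
    have h1 : Measurable fun s : (ℤ → X) × U => F (s.1 n, s.2) :=
      hF.measurable.comp (((measurable_pi_apply n).comp measurable_fst).prodMk measurable_snd)
    refine Measurable.prodMk (measurable_pi_lambda _ fun m => ?_) h1.snd
    rcases eq_or_ne m n with rfl | h
    · simpa using h1.fst
    · simpa [Function.update_of_ne h, Function.comp_def] using
        (measurable_pi_apply m).comp measurable_fst
  refine ⟨hm, ?_⟩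
  -- The coordinate at `n` is written as a fresh independent sample, inserted by `hR`. Passing
  -- through `n` then amounts to applying `F` to the sample and the carrier before the insertion.
  conv_lhs => rw [← hR.map_eq]
  rw [Measure.map_map hm hR.measurable]
  have hcomp := hR.comp ((MeasurePreserving.id (iidMeasure μ)).prod hF)
  convert hcomp.map_eq using 2
  ext ⟨x, a, w⟩ <;> simp [step]

theorem measurePreserving_run {μ : Measure X} {ν : Measure U} [IsProbabilityMeasure μ]
    [IsProbabilityMeasure ν] (hF : MeasurePreserving F (μ.prod ν) (μ.prod ν)) (a : ℤ) (k : ℕ) :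
    MeasurePreserving (run F a k) ((iidMeasure μ).prod ν) ((iidMeasure μ).prod ν) := by
  induction k with
  | zero => exact MeasurePreserving.id _
  | succ k ih => exact (measurePreserving_step hF _).comp ih

end Measure

/-! ### The limit of a carrier started infinitely far to the left. -/

section Topology

variable {X U : Type*} [TopologicalSpace X] [TopologicalSpace U] {F : X × U → X × U}

theorem tendsto_run {C : (ℤ → X) → ℤ → U} (hF : Continuous F) {x : ℤ → X} {w : U}
    (h : ∀ n : ℤ, Filter.Tendsto (fun N : ℕ => carrierFrom F x w (-N) (n + N).toNat) Filter.atTop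
      (nhds (C x n))) :
    Filter.Tendsto (fun N : ℕ => (run F (-N) (2 * N) (x, w)).1) Filter.atTop
      (nhds (output F C x)) := by
  refine tendsto_pi_nhds.2 fun n => ?_
  have h1 : Filter.Tendsto
      (fun N : ℕ => (F (x n, carrierFrom F x w (-N) (n - 1 + N).toNat)).1) Filter.atTop
      (nhds (output F C x n)) :=
    (continuous_fst.comp hF).continuousAt.tendsto.comp (tendsto_const_nhds.prodMk_nhds (h (n - 1)))
  refine h1.congr' ?_
  -- The run from `-N` of length `2 * N` passes through `-N + 1, …, N`, which eventually contains
  -- `n`.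
  filter_upwards [Filter.eventually_ge_atTop (n.natAbs + 1)] with N hN
  rw [(run_apply F (-N) x w (2 * N)).2 n, if_pos (by push_cast; omega), sub_neg_eq_add]

variable [TopologicalSpace.MetrizableSpace X] [SecondCountableTopology X] [MeasurableSpace X]
  [BorelSpace X] [MeasurableSpace U] {μ : Measure X} {ν : Measure U} [IsProbabilityMeasure μ]
  [IsProbabilityMeasure ν] {C : (ℤ → X) → ℤ → U}

/-- With the initial carrier value drawn from `ν`, the configuration after every finite run has law
`iidMeasure μ`, so the integral of a bounded continuous function does not depend on `N`. Dominated
convergence identifies it with the integral for the limiting output. -/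
theorem map_output_iidMeasure (hF : Continuous F) (hFm : MeasurePreserving F (μ.prod ν) (μ.prod ν))
    (hC : ∀ᵐ x ∂iidMeasure μ, ∀ (w : U) (n : ℤ),
      Filter.Tendsto (fun N : ℕ => carrierFrom F x w (-N) (n + N).toNat) Filter.atTop
        (nhds (C x n))) :
    AEMeasurable (output F C) (iidMeasure μ) ∧
      (iidMeasure μ).map (output F C) = iidMeasure μ := by
  let _ := TopologicalSpace.metrizableSpaceMetric X
  have hmeas : AEMeasurable (output F C) (iidMeasure μ) := by
    obtain ⟨w⟩ : Nonempty U := ν.nonempty_of_neZero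
    refine aemeasurable_of_tendsto_metrizable_ae Filter.atTop
      (f := fun (N : ℕ) x => (run F (-N) (2 * N) (x, w)).1) (fun N => ?_) ?_
    · exact ((measurePreserving_run hFm _ _).measurable.comp
        (measurable_id.prodMk measurable_const)).fst.aemeasurable
    · filter_upwards [hC] with x hx using tendsto_run hF (hx w)
  refine ⟨hmeas, ?_⟩
  have := Measure.isProbabilityMeasure_map hmeas
  refine ext_of_forall_integral_eq_of_IsFiniteMeasure fun f => ?_
  rw [integral_map hmeas f.continuous.aestronglyMeasurable]
  have hfst : MeasurePreserving Prod.fst ((iidMeasure μ).prod ν) (iidMeasure μ) :=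
    measurePreserving_fst
  have hlim : Filter.Tendsto
      (fun N : ℕ => ∫ p, f (run F (-N) (2 * N) p).1 ∂(iidMeasure μ).prod ν) Filter.atTop
      (nhds (∫ p, f (output F C p.1) ∂(iidMeasure μ).prod ν)) := by
    refine tendsto_integral_of_dominated_convergence (fun _ => ‖f‖) (fun N => ?_)
      (integrable_const _) (fun N => .of_forall fun p => f.norm_coe_le_norm _) ?_
    · exact (f.continuous.measurable.comp
        (measurePreserving_run hFm _ _).measurable.fst).aestronglyMeasurable
    · filter_upwards [hfst.quasiMeasurePreserving.ae hC] with p hp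
      exact (f.continuous.tendsto _).comp (tendsto_run hF (hp p.2))
  have hconst : ∀ N : ℕ, ∫ p, f (run F (-N) (2 * N) p).1 ∂(iidMeasure μ).prod ν
      = ∫ x, f x ∂iidMeasure μ := fun N => by
    have h1 := hfst.comp (measurePreserving_run hFm (-N) (2 * N))
    conv_rhs => rw [← h1.map_eq]
    rw [integral_map h1.measurable.aemeasurable f.continuous.aestronglyMeasurable]
    rfl
  simp_rw [hconst] at hlim
  have h1 := tendsto_nhds_unique tendsto_const_nhds hlim
  rw [h1, integral_fun_fst (μ := iidMeasure μ) (ν := ν) fun x => f (output F C x)]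
  simp

theorem IsSelection.isInvariantOn {G : Set (ℤ → X)} (hG : IsSelection F G C)
    (hinv : Function.Involutive F)
    (hF : Continuous F) (hFm : MeasurePreserving F (μ.prod ν) (μ.prod ν))
    (hmem : ∀ᵐ x ∂iidMeasure μ, x ∈ G)
    (hC : ∀ᵐ x ∂iidMeasure μ, ∀ (w : U) (n : ℤ),
      Filter.Tendsto (fun N : ℕ => carrierFrom F x w (-N) (n + N).toNat) Filter.atTop
        (nhds (C x n))) :
    IsInvariantOn F (uniqueSolution F) (iidMeasure μ) := by
  obtain ⟨hm, hmap⟩ := map_output_iidMeasure hF hFm hC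
  -- Invariance of the measure carries the almost sure membership in `G` from each iterate to the
  -- next. Reflection invariance then supplies the same for the past.
  have hiter : ∀ k : ℕ, ∀ᵐ x ∂iidMeasure μ, (output F C)^[k] x ∈ G := by
    intro k
    induction k with
    | zero => exact hmem
    | succ k ih =>
      rw [← hmap] at ih
      exact ae_of_ae_map hm ih
  have hgood : ∀ᵐ x ∂iidMeasure μ, x ∈ uniqueSolution F ∧ dynamics F x = output F C x := by
    filter_upwards [ae_all_iff.2 hiter,
      (measurePreserving_reverse_iidMeasure μ).quasiMeasurePreserving.ae (ae_all_iff.2 hiter)]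
      with x h1 h2 using hG.mem_uniqueSolution hinv h1 h2
  have heq : dynamics F =ᵐ[iidMeasure μ] output F C := hgood.mono fun x hx => hx.2
  exact ⟨hgood.mono fun x hx => hx.1, hm.congr heq.symm, (Measure.map_congr heq).trans hmap⟩

end Topology

end Lattice

/-! ### Algebra of the lattice map and its invariant product measures. -/

namespace DKdV

theorem coe_map_fst (α β : ℝ≥0) (p : PosReal × PosReal) :
    ((map α β p).1 : ℝ) = p.2 * (1 + β * p.1 * p.2) / (1 + α * p.1 * p.2) := rfl

theorem coe_map_snd (α β : ℝ≥0) (p : PosReal × PosReal) :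
    ((map α β p).2 : ℝ) = p.1 * (1 + α * p.1 * p.2) / (1 + β * p.1 * p.2) := rfl

theorem map_fst_mul_map_snd (α β : ℝ≥0) (p : PosReal × PosReal) :
    ((map α β p).1 : ℝ) * (map α β p).2 = p.1 * p.2 := by
  have hx : 0 < (p.1 : ℝ) := p.1.2
  have hu : 0 < (p.2 : ℝ) := p.2.2
  have h1 : (0 : ℝ) < 1 + α * p.1 * p.2 := by positivity
  have h2 : (0 : ℝ) < 1 + β * p.1 * p.2 := by positivity
  rw [coe_map_fst, coe_map_snd]
  field_simp

theorem involutive_map (α β : ℝ≥0) : Function.Involutive (map α β) := by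
  intro p
  have hx : 0 < (p.1 : ℝ) := p.1.2
  have hu : 0 < (p.2 : ℝ) := p.2.2
  have h1 : (0 : ℝ) < 1 + α * p.1 * p.2 := by positivity
  have h2 : (0 : ℝ) < 1 + β * p.1 * p.2 := by positivity
  refine Prod.ext (Subtype.ext ?_) (Subtype.ext ?_)
  · rw [coe_map_fst, mul_assoc, mul_assoc, map_fst_mul_map_snd, coe_map_snd, ← mul_assoc,
      ← mul_assoc]
    field_simp
  · rw [coe_map_snd, mul_assoc, mul_assoc, map_fst_mul_map_snd, coe_map_fst, ← mul_assoc,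
      ← mul_assoc]
    field_simp

theorem continuous_map (α β : ℝ≥0) : Continuous (map α β) := by
  have h : ∀ γ : ℝ≥0, ∀ p : PosReal × PosReal, (1 + γ * p.1 * p.2 : ℝ) ≠ 0 := fun γ p => by
    have hx : 0 < (p.1 : ℝ) := p.1.2
    have hu : 0 < (p.2 : ℝ) := p.2.2
    positivity
  refine Continuous.prodMk (Continuous.subtype_mk ?_ _) (Continuous.subtype_mk ?_ _)
  · exact Continuous.div₀ (by fun_prop) (by fun_prop) (h α)
  · exact Continuous.div₀ (by fun_prop) (by fun_prop) (h β)

theorem map_swap (α β : ℝ≥0) (p : PosReal × PosReal) :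
    map α β p = (map β α p.swap).swap := by
  refine Prod.ext (Subtype.ext ?_) (Subtype.ext ?_)
  · simp only [Prod.fst_swap, Prod.snd_swap, coe_map_fst, coe_map_snd, mul_right_comm]
  · simp only [Prod.fst_swap, Prod.snd_swap, coe_map_fst, coe_map_snd, mul_right_comm]

theorem map_self (α : ℝ≥0) : map α α = Prod.swap := by
  funext p
  have hx : 0 < (p.1 : ℝ) := p.1.2
  have hu : 0 < (p.2 : ℝ) := p.2.2
  have h1 : (1 + α * p.1 * p.2 : ℝ) ≠ 0 := by positivity
  refine Prod.ext (Subtype.ext ?_) (Subtype.ext ?_)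
  · simp only [coe_map_fst, Prod.fst_swap]
    field_simp
  · simp only [coe_map_snd, Prod.snd_swap]
    field_simp

/-- The exponential function as a map to `(0, ∞)`. -/
noncomputable def posExp (t : ℝ) : PosReal := ⟨Real.exp t, Real.exp_pos t⟩

theorem measurable_posExp : Measurable posExp := Real.measurable_exp.subtype_mk

/-- The Haar measure `dx / x` of the multiplicative group `(0, ∞)`. -/
noncomputable def logMeasure : Measure PosReal := (volume : Measure ℝ).map posExp

instance : SFinite logMeasure := by
  unfold logMeasure
  infer_instance

theorem measurePreserving_posExp : MeasurePreserving posExp volume logMeasure :=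
  ⟨measurable_posExp, rfl⟩

/-- The map keeps the sum of the coordinates. In the coordinates (sum, entry) it is a reflection and
translation of each fibre, so it factors into skew products and swaps. -/
theorem measurePreserving_shear {g : ℝ → ℝ} (hg : Measurable g) :
    MeasurePreserving (fun p : ℝ × ℝ => (p.2 + g (p.1 + p.2), p.1 - g (p.1 + p.2)))
      (volume.prod volume) (volume.prod volume) := by
  have h1 : MeasurePreserving (fun p : ℝ × ℝ => (p.1, p.1 + p.2)) (volume.prod volume)
      (volume.prod volume) :=
    (MeasurePreserving.id volume).skew_product (g := fun a b => a + b) (by fun_prop)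
      (.of_forall fun a => (measurePreserving_add_left volume a).map_eq)
  have h2 : MeasurePreserving (fun p : ℝ × ℝ => (p.1, (p.1 + g p.1) - p.2)) (volume.prod volume)
      (volume.prod volume) :=
    (MeasurePreserving.id volume).skew_product (g := fun a b => (a + g a) - b) (by fun_prop)
      (.of_forall fun a => (Measure.measurePreserving_sub_left volume _).map_eq)
  have h3 : MeasurePreserving (fun p : ℝ × ℝ => (p.1, p.2 - p.1)) (volume.prod volume)
      (volume.prod volume) :=
    (MeasurePreserving.id volume).skew_product (g := fun a b => b - a) (by fun_prop)
      (.of_forall fun a => (measurePreserving_sub_right volume a).map_eq)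
  have hs : MeasurePreserving (Prod.swap : ℝ × ℝ → ℝ × ℝ) (volume.prod volume)
      (volume.prod volume) := Measure.measurePreserving_swap
  convert h3.comp (hs.comp (h2.comp (hs.comp h1))) using 1
  funext p
  simp only [Function.comp_apply, Prod.swap]
  ext <;> simp <;> ring

theorem measurePreserving_map_logMeasure (α β : ℝ≥0) :
    MeasurePreserving (map α β) (logMeasure.prod logMeasure) (logMeasure.prod logMeasure) := by
  set g : ℝ → ℝ := fun s => Real.log (1 + β * Real.exp s) - Real.log (1 + α * Real.exp s)
  have hg : Measurable g := by fun_prop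
  have he : MeasurePreserving (Prod.map posExp posExp) (volume.prod volume)
      (logMeasure.prod logMeasure) := measurePreserving_posExp.prod measurePreserving_posExp
  have hm : Measurable (map α β) := (continuous_map α β).measurable
  refine ⟨hm, ?_⟩
  conv_lhs => rw [← he.map_eq]
  rw [Measure.map_map hm he.measurable]
  convert (he.comp (measurePreserving_shear hg)).map_eq using 2
  funext p
  have h1 : (0 : ℝ) < 1 + α * (Real.exp p.1 * Real.exp p.2) := by positivity
  have h2 : (0 : ℝ) < 1 + β * (Real.exp p.1 * Real.exp p.2) := by positivity
  refine Prod.ext (Subtype.ext ?_) (Subtype.ext ?_)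
  · simp only [Function.comp_apply, coe_map_fst, Prod.map, posExp, g, Real.exp_add, Real.exp_sub,
      Real.exp_log h1, Real.exp_log h2, mul_assoc]
    rw [mul_div_assoc]
  · simp only [Function.comp_apply, coe_map_snd, Prod.map, posExp, g, Real.exp_add, Real.exp_sub,
      Real.exp_log h1, Real.exp_log h2, mul_assoc]
    field_simp

theorem comap_volume_eq_withDensity :
    (volume : Measure ℝ).comap (Subtype.val : PosReal → ℝ)
      = logMeasure.withDensity fun x => ENNReal.ofReal x := by
  have hS : MeasurableSet {x : ℝ | 0 < x} := measurableSet_Ioi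
  ext s hs
  refine ((MeasurableEmbedding.subtype_coe hS).comap_apply volume s).trans ?_
  rw [withDensity_apply _ hs, logMeasure,
    setLIntegral_map hs (by fun_prop) measurable_posExp]
  have himg : (Subtype.val : PosReal → ℝ) '' s = Real.exp '' (posExp ⁻¹' s) := by
    ext y
    constructor
    · rintro ⟨x, hx, rfl⟩
      refine ⟨Real.log x, ?_, Real.exp_log x.2⟩
      have h1 : posExp (Real.log x) = x := Subtype.ext (Real.exp_log x.2)
      rwa [Set.mem_preimage, h1]
    · rintro ⟨t, ht, rfl⟩
      exact ⟨posExp t, ht, rfl⟩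
  refine (congrArg volume himg).trans ?_
  rw [← setLIntegral_one, lintegral_image_eq_lintegral_abs_deriv_mul
    (measurable_posExp hs) (fun t _ => (Real.hasDerivAt_exp t).hasDerivWithinAt)
    Real.exp_injective.injOn]
  simp [posExp]

theorem densityMeasure_eq_withDensity {w : ℝ → ℝ} (hw : Measurable w) :
    densityMeasure w = logMeasure.withDensity
      fun x : PosReal => ENNReal.ofReal (x * w x) := by
  rw [densityMeasure, comap_volume_eq_withDensity, ← withDensity_mul _ (by fun_prop) (by fun_prop)]
  congr 1
  funext x
  rw [Pi.mul_apply, ENNReal.ofReal_mul x.2.le]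

end DKdV

theorem MeasureTheory.MeasurePreserving.withDensity_invariant {Ω : Type*} [MeasurableSpace Ω]
    {M : Measure Ω} {T : Ω → Ω} (hT : MeasurePreserving T M M) {D : Ω → ℝ≥0∞} (hD : Measurable D)
    (hDT : ∀ p, D (T p) = D p) : MeasurePreserving T (M.withDensity D) (M.withDensity D) := by
  refine ⟨hT.measurable, ?_⟩
  ext s hs
  rw [Measure.map_apply hT.measurable hs, withDensity_apply _ (hT.measurable hs),
    withDensity_apply _ hs]
  conv_rhs => rw [← hT.map_eq]
  rw [setLIntegral_map hs hD hT.measurable]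
  simp_rw [hDT]

namespace DKdV

/-- With respect to `dx/x ⊗ du/u` the density is, up to a constant, `(x u)^(-l) * exp (-c (1/x + β u
+ 1/u))`, a function of two conserved quantities. Equal `l` in the two factors yields the power of
`x u`; the rate `c * β` completes the second invariant. -/
theorem measurePreserving_map_inverseGamma_gig (β : ℝ≥0) {l c : ℝ} (hl : 0 < l) (hc : 0 < c) :
    MeasurePreserving (map 0 β) ((inverseGamma l c).prod (gig l (c * β) c))
      ((inverseGamma l c).prod (gig l (c * β) c)) := by
  have h1 := isProbabilityMeasure_inverseGamma hl hc
  have h2 := isProbabilityMeasure_gig hl (c₁ := c * β) (by positivity) hc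
  unfold inverseGamma gig normalizedDensity at *
  set w₁ : ℝ → ℝ := fun x => x ^ (-l - 1) * Real.exp (-c * x⁻¹) with hw₁
  set w₂ : ℝ → ℝ := fun x => x ^ (-l - 1) * Real.exp (-(c * β) * x - c * x⁻¹) with hw₂
  have hm₁ : Measurable w₁ := by fun_prop
  have hm₂ : Measurable w₂ := by fun_prop
  rw [densityMeasure_eq_withDensity hm₁, densityMeasure_eq_withDensity hm₂] at *
  set d₁ : PosReal → ℝ≥0∞ := fun x => ENNReal.ofReal (x * w₁ x) with hd₁
  set d₂ : PosReal → ℝ≥0∞ := fun x => ENNReal.ofReal (x * w₂ x) with hd₂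
  have hmd₁ : Measurable d₁ := by fun_prop
  have hmd₂ : Measurable d₂ := by fun_prop
  rw [← withDensity_smul _ hmd₁, ← withDensity_smul _ hmd₂,
    prod_withDensity (hmd₁.const_smul _) (hmd₂.const_smul _)]
  refine (measurePreserving_map_logMeasure 0 β).withDensity_invariant
    (((hmd₁.const_smul _).comp measurable_fst).mul ((hmd₂.const_smul _).comp measurable_snd))
    fun p => ?_
  simp only [Pi.smul_apply, smul_eq_mul]
  have hd : ∀ q : PosReal × PosReal, d₁ q.1 * d₂ q.2 = ENNReal.ofReal (((q.1 : ℝ) * q.2) ^ (-l) *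
      Real.exp (-c * ((q.1 : ℝ)⁻¹ + β * q.2 + (q.2 : ℝ)⁻¹))) := by
    rintro ⟨⟨x, hx⟩, u, hu⟩
    have hx' : x * x ^ (-l - 1) = x ^ (-l) := by
      rw [← Real.rpow_one_add' hx.le (by linarith)]
      ring_nf
    have hu' : u * u ^ (-l - 1) = u ^ (-l) := by
      rw [← Real.rpow_one_add' hu.le (by linarith)]
      ring_nf
    have he : Real.exp (-c * (x⁻¹ + β * u + u⁻¹)) =
        Real.exp (-c * x⁻¹) * Real.exp (-(c * β) * u - c * u⁻¹) := by
      rw [← Real.exp_add]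
      ring_nf
    simp only [hd₁, hd₂, hw₁, hw₂]
    rw [← ENNReal.ofReal_mul (by positivity), Real.mul_rpow hx.le hu.le, he, ← hx', ← hu']
    congr 1
    ring
  simp only [mul_mul_mul_comm _ (d₁ _), hd, map_fst_mul_map_snd]
  congr 5
  have hx : 0 < (p.1 : ℝ) := p.1.2
  have hu : 0 < (p.2 : ℝ) := p.2.2
  have h3 : (1 + β * p.1 * p.2 : ℝ) ≠ 0 := by positivity
  simp only [coe_map_fst, coe_map_snd, NNReal.coe_zero, zero_mul, add_zero, mul_one, div_one]
  field_simp
  ring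

theorem measurePreserving_map_gig_inverseGamma (α : ℝ≥0) {l c : ℝ} (hl : 0 < l) (hc : 0 < c) :
    MeasurePreserving (map α 0) ((gig l (c * α) c).prod (inverseGamma l c))
      ((gig l (c * α) c).prod (inverseGamma l c)) := by
  have h1 := isProbabilityMeasure_inverseGamma hl hc
  have h2 := isProbabilityMeasure_gig hl (c₁ := c * α) (by positivity) hc
  have h : map α 0 = Prod.swap ∘ map 0 α ∘ Prod.swap := funext fun p => map_swap α 0 p
  rw [h]
  exact Measure.measurePreserving_swap.comp
    ((measurePreserving_map_inverseGamma_gig α hl hc).comp Measure.measurePreserving_swap)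

end DKdV

/-! ### Carriers started at finite positions, and the case `α = β`. -/

namespace Lattice

variable {X U : Type*} {F : X × U → X × U}

theorem IsCarrier.eq_carrierFrom {x : ℤ → X} {u : ℤ → U} (hu : IsCarrier F x u) (a : ℤ) (k : ℕ) :
    u (a + k) = carrierFrom F x (u a) a k := by
  induction k with
  | zero => simp [carrierFrom]
  | succ k ih =>
    have h := hu (a + k + 1)
    rw [add_sub_cancel_right, ih] at h
    rw [carrierFrom, h]
    congr 1
    push_cast
    ring

theorem carrierFrom_toNat (x : ℤ → X) (w : U) {a n : ℤ} (h : a < n) :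
    carrierFrom F x w a (n - a).toNat
      = (F (x n, carrierFrom F x w a (n - 1 - a).toNat)).2 := by
  have h1 : (n - a).toNat = (n - 1 - a).toNat + 1 := by omega
  rw [h1, carrierFrom]
  congr 4
  omega

theorem isCarrier_of_tendsto [TopologicalSpace X] [TopologicalSpace U] [T2Space U]
    (hF : Continuous F) {x : ℤ → X} {w : U} {u : ℤ → U}
    (h : ∀ n : ℤ, Filter.Tendsto (fun N : ℕ => carrierFrom F x w (-N) (n + N).toNat) Filter.atTop
      (nhds (u n))) : IsCarrier F x u := by
  intro n
  have h1 : Filter.Tendsto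
      (fun N : ℕ => (F (x n, carrierFrom F x w (-N) (n - 1 + N).toNat)).2) Filter.atTop
      (nhds (F (x n, u (n - 1))).2) :=
    (continuous_snd.comp hF).continuousAt.tendsto.comp (tendsto_const_nhds.prodMk_nhds (h (n - 1)))
  refine tendsto_nhds_unique h1 ((h n).congr' ?_)
  filter_upwards [Filter.eventually_ge_atTop (n.natAbs + 1)] with N hN
  simpa using carrierFrom_toNat (F := F) x w (a := -N) (n := n) (by omega)

theorem IsInvariantOn.inter [MeasurableSpace X] {D D' : Set (ℤ → X)} {P : Measure (ℤ → X)}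
    (h : IsInvariantOn F D P) (h' : ∀ᵐ x ∂P, x ∈ D') : IsInvariantOn F (D ∩ D') P :=
  ⟨h.1.and h', h.2⟩

/-- For the swap a configuration is its own unique carrier, and the output is its shift by one site.
-/
theorem isInvariantOn_swap [TopologicalSpace X] [TopologicalSpace.MetrizableSpace X]
    [SecondCountableTopology X] [MeasurableSpace X] [BorelSpace X] (μ : Measure X)
    [IsProbabilityMeasure μ] :
    IsInvariantOn (Prod.swap : X × X → X × X) (uniqueSolution Prod.swap) (iidMeasure μ) := by
  have hsel : IsSelection (Prod.swap : X × X → X × X) Set.univ id :=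
    ⟨fun x _ n => rfl, fun x _ u v hu _ => funext fun n => (hu n).symm⟩
  refine hsel.isInvariantOn (ν := μ) Prod.swap_swap continuous_swap
    Measure.measurePreserving_swap (by simp) (.of_forall fun x w n => ?_)
  refine tendsto_const_nhds.congr' ?_
  filter_upwards [Filter.eventually_ge_atTop (n.natAbs + 1)] with N hN
  simpa using (carrierFrom_toNat (F := Prod.swap) x w (a := -N) (n := n) (by omega)).symm

end Lattice

/-! ### Gains, and the affine carrier equation of the case `β = 0`. -/

namespace DKdV

open Lattice Filter Topology

/-- The product of `γ x_m²` over the `k` positions `m` that end at `n`. -/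
noncomputable def gain (γ : ℝ) (x : ℤ → PosReal) (n : ℤ) (k : ℕ) : ℝ :=
  ∏ j ∈ Finset.range k, γ * (x (n - j) : ℝ) ^ 2

theorem gain_pos {γ : ℝ} (hγ : 0 < γ) (x : ℤ → PosReal) (n : ℤ) (k : ℕ) : 0 < gain γ x n k :=
  Finset.prod_pos fun j _ => by
    have := (x (n - j)).2
    positivity

theorem gain_succ (γ : ℝ) (x : ℤ → PosReal) (n : ℤ) (k : ℕ) :
    gain γ x n (k + 1) = gain γ x n k * (γ * (x (n - k) : ℝ) ^ 2) :=
  Finset.prod_range_succ _ _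

theorem gain_succ' (γ : ℝ) (x : ℤ → PosReal) (n : ℤ) (k : ℕ) :
    gain γ x (n + 1) (k + 1) = γ * (x (n + 1) : ℝ) ^ 2 * gain γ x n k := by
  rw [gain, Finset.prod_range_succ', mul_comm, gain]
  congr 1
  · simp
  · refine Finset.prod_congr rfl fun j _ => ?_
    congr 4
    push_cast
    ring

section Growing

variable {α : ℝ≥0}

/-- The `k`-th summand of the series that solves the affine carrier equation. -/
noncomputable def carrierTerm (γ : ℝ) (x : ℤ → PosReal) (n : ℤ) (k : ℕ) : ℝ :=
  x (n - k) * gain γ x n k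

theorem carrierTerm_pos {γ : ℝ} (hγ : 0 < γ) (x : ℤ → PosReal) (n : ℤ) (k : ℕ) :
    0 < carrierTerm γ x n k :=
  mul_pos (x (n - k)).2 (gain_pos hγ x n k)

/-- This identity trades bounds on the series terms for bounds on products of two consecutive gains.
It is used in both directions: for summability and for uniqueness. -/
theorem mul_carrierTerm_sq (γ : ℝ) (x : ℤ → PosReal) (n : ℤ) (k : ℕ) :
    γ * carrierTerm γ x n k ^ 2 = gain γ x n k * gain γ x n (k + 1) := by
  rw [gain_succ, carrierTerm]
  ring

theorem coe_map_zero_right_snd (α : ℝ≥0) (p : PosReal × PosReal) :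
    ((map α 0 p).2 : ℝ) = p.1 + α * (p.1 : ℝ) ^ 2 * p.2 := by
  rw [coe_map_snd]
  simp
  ring

theorem carrierFrom_map_zero_right (x : ℤ → PosReal) (w : PosReal) (a : ℤ) (k : ℕ) :
    ((carrierFrom (map α 0) x w a k : PosReal) : ℝ)
      = ∑ j ∈ Finset.range k, carrierTerm α x (a + k) j + gain α x (a + k) k * w := by
  induction k with
  | zero => simp [carrierFrom, gain]
  | succ k ih =>
    have h : (a + (k + 1 : ℕ) : ℤ) = a + k + 1 := by
      push_cast
      ring
    rw [carrierFrom, coe_map_zero_right_snd, ih, h, gain_succ', Finset.sum_range_succ']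
    have h1 : ∀ j : ℕ, carrierTerm α x (a + k + 1) (j + 1)
        = α * (x (a + k + 1) : ℝ) ^ 2 * carrierTerm α x (a + k) j := fun j => by
      rw [carrierTerm, gain_succ', carrierTerm]
      have h2 : (a + k + 1 - (j + 1 : ℕ) : ℤ) = a + k - j := by
        push_cast
        ring
      rw [h2]
      ring
    have h0 : carrierTerm α x (a + k + 1) 0 = x (a + k + 1) := by simp [carrierTerm, gain]
    simp_rw [h1, ← Finset.mul_sum, h0]
    ring

/-- The smallest solution of the affine carrier equation. -/
noncomputable def minimalCarrier (α : ℝ≥0) (x : ℤ → PosReal) (n : ℤ) : PosReal :=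
  -- The zeroth term is split off so that the value is positive even if the series diverges and its
  -- `tsum` is `0`.
  ⟨x n + ∑' k, carrierTerm α x n (k + 1), add_pos_of_pos_of_nonneg (x n).2
    (tsum_nonneg fun _ => mul_nonneg (x _).2.le
      (Finset.prod_nonneg fun _ _ => mul_nonneg α.2 (sq_nonneg _)))⟩

/-- The configurations for which the series for the carrier converges and the gains decay. -/
def summableConfigs (α : ℝ≥0) : Set (ℤ → PosReal) :=
  {x | ∀ n, Tendsto (gain α x n) atTop (𝓝 0) ∧ Summable (carrierTerm α x n)}

theorem coe_minimalCarrier {x : ℤ → PosReal} (hx : x ∈ summableConfigs α) (n : ℤ) :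
    (minimalCarrier α x n : ℝ) = ∑' k, carrierTerm α x n k := by
  rw [(hx n).2.tsum_eq_zero_add]
  simp [minimalCarrier, carrierTerm, gain]

theorem tendsto_carrierFrom_minimalCarrier {x : ℤ → PosReal} (hx : x ∈ summableConfigs α)
    (w : PosReal) (n : ℤ) :
    Tendsto (fun N : ℕ => carrierFrom (map α 0) x w (-N) (n + N).toNat) atTop
      (𝓝 (minimalCarrier α x n)) := by
  rw [tendsto_subtype_rng, coe_minimalCarrier hx]
  have hk : Tendsto (fun N : ℕ => (n + N).toNat) atTop atTop :=
    tendsto_atTop.2 fun b => by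
      filter_upwards [eventually_ge_atTop (n.natAbs + b)] with N hN
      omega
  have h1 := ((hx n).2.hasSum.tendsto_sum_nat.add ((hx n).1.mul_const (w : ℝ))).comp hk
  rw [zero_mul, add_zero] at h1
  refine h1.congr' ?_
  filter_upwards [eventually_ge_atTop n.natAbs] with N hN
  rw [carrierFrom_map_zero_right, Function.comp_apply,
    show -(N : ℤ) + ((n + N).toNat : ℕ) = n by omega]

/-- A carrier `u` exceeding the minimal one by `h > 0` at `n` satisfies `h ≤ gain α x n k * u (n -
k)`, so it blows up to the left. Since `y m * u m = x m * u (m - 1)` for its output `y`, the gains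
of `y` are at least of order `1 / gain α x n k`. A carrier of `y` would bound the products of
consecutive gains of `y`, a contradiction. -/
theorem isSelection_minimalCarrier (hα : 0 < α) :
    IsSelection (map α 0) (summableConfigs α) (minimalCarrier α) := by
  have hcar : ∀ x ∈ summableConfigs α, IsCarrier (map α 0) x (minimalCarrier α x) := fun x hx =>
    isCarrier_of_tendsto (continuous_map α 0) (w := ⟨1, one_pos⟩)
      (tendsto_carrierFrom_minimalCarrier hx _)
  refine ⟨hcar, fun x hx u v hu hv => funext fun n => Subtype.ext ?_⟩
  have hα' : (0 : ℝ) < α := hα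
  have hur : ∀ k : ℕ, (u n : ℝ)
      = ∑ j ∈ Finset.range k, carrierTerm α x n j + gain α x n k * u (n - k) := fun k => by
    have h := hu.eq_carrierFrom (n - k) k
    rw [sub_add_cancel] at h
    rw [h, carrierFrom_map_zero_right, sub_add_cancel]
  have hcr : ∀ k : ℕ, (minimalCarrier α x n : ℝ)
      = ∑ j ∈ Finset.range k, carrierTerm α x n j
        + gain α x n k * minimalCarrier α x (n - k) := fun k => by
    have h := (hcar x hx).eq_carrierFrom (n - k) k
    rw [sub_add_cancel] at h
    rw [h, carrierFrom_map_zero_right, sub_add_cancel]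
  have hle : (minimalCarrier α x n : ℝ) ≤ u n := by
    rw [coe_minimalCarrier hx]
    refine le_of_tendsto' (hx n).2.hasSum.tendsto_sum_nat fun k => ?_
    rw [hur k]
    exact le_add_of_nonneg_right (mul_nonneg (gain_pos hα' x n k).le (u _).2.le)
  by_contra hne
  have hh : (0 : ℝ) < u n - minimalCarrier α x n :=
    sub_pos.2 (lt_of_le_of_ne hle (Ne.symm hne))
  set h : ℝ := u n - minimalCarrier α x n with hdef
  set y : ℤ → PosReal := fun m => (map α 0 (x m, u (m - 1))).1 with hy
  have hyu : ∀ m, (y m : ℝ) * u m = x m * u (m - 1) := fun m => by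
    have h1 := map_fst_mul_map_snd α 0 (x m, u (m - 1))
    rwa [hu m] at h1
  -- The relation `hyu` telescopes along the `k` sites.
  have hgain : ∀ k : ℕ, gain α y n k * (u n : ℝ) ^ 2 = gain α x n k * (u (n - k) : ℝ) ^ 2 := by
    intro k
    induction k with
    | zero => simp [gain]
    | succ k ih =>
      have h1 := hyu (n - k)
      have h2 : (n - (k + 1 : ℕ) : ℤ) = n - k - 1 := by
        push_cast
        ring
      rw [gain_succ, gain_succ, h2]
      calc gain α y n k * (α * (y (n - k) : ℝ) ^ 2) * (u n : ℝ) ^ 2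
          = (gain α y n k * (u n : ℝ) ^ 2) * (α * (y (n - k) : ℝ) ^ 2) := by ring
        _ = gain α x n k * α * ((y (n - k) : ℝ) * u (n - k)) ^ 2 := by
          rw [ih]
          ring
        _ = _ := by
          rw [h1]
          ring
  have hlow : ∀ k : ℕ, h ^ 2 ≤ gain α x n k * gain α y n k * (u n : ℝ) ^ 2 := fun k => by
    have h1 : h ≤ gain α x n k * u (n - k) := by
      rw [hdef, sub_le_iff_le_add, hcr k]
      have h2 := hur k
      have h3 := mul_pos (gain_pos hα' x n k) (minimalCarrier α x (n - k)).2
      have h4 : 0 ≤ ∑ j ∈ Finset.range k, carrierTerm α x n j :=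
        Finset.sum_nonneg fun j _ => (carrierTerm_pos hα' x n j).le
      linarith
    rw [mul_assoc, hgain k]
    calc h ^ 2 ≤ (gain α x n k * u (n - k)) ^ 2 := pow_le_pow_left₀ hh.le h1 2
      _ = _ := by ring
  -- Unfolding `k + 1` steps makes the term of index `k` one of the positive summands of `v n`.
  have hv' : ∀ k : ℕ, carrierTerm α y n k ≤ v n := fun k => by
    have h1 := hv.eq_carrierFrom (n - (k + 1 : ℕ)) (k + 1)
    rw [sub_add_cancel] at h1
    rw [h1, carrierFrom_map_zero_right, sub_add_cancel]
    refine (Finset.single_le_sum (f := fun j => carrierTerm α y n j)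
      (fun j _ => (carrierTerm_pos hα' y n j).le)
      (Finset.mem_range.2 (Nat.lt_succ_self k))).trans ?_
    exact le_add_of_nonneg_right (mul_nonneg (gain_pos hα' y n _).le (v _).2.le)
  -- The bound `hv'` controls only products of consecutive gains, so the lower bounds for `k` and `k
  -- + 1` are multiplied.
  have hbound : ∀ k : ℕ, h ^ 4 ≤
      gain α x n k * gain α x n (k + 1) * (α * (v n : ℝ) ^ 2 * (u n : ℝ) ^ 4) := fun k => by
    have h1 := mul_le_mul (hlow k) (hlow (k + 1)) (sq_nonneg h)
      ((sq_nonneg h).trans (hlow k))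
    have h2 : gain α y n k * gain α y n (k + 1) ≤ α * (v n : ℝ) ^ 2 := by
      rw [← mul_carrierTerm_sq]
      exact mul_le_mul_of_nonneg_left
        (pow_le_pow_left₀ (carrierTerm_pos hα' y n k).le (hv' k) 2) hα'.le
    have h3 := mul_le_mul_of_nonneg_left h2 (mul_nonneg (mul_pos (gain_pos hα' x n k)
      (gain_pos hα' x n (k + 1))).le (pow_nonneg (u n).2.le 4))
    calc h ^ 4 = h ^ 2 * h ^ 2 := by ring
      _ ≤ _ := h1
      _ = gain α x n k * gain α x n (k + 1) * (u n : ℝ) ^ 4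
          * (gain α y n k * gain α y n (k + 1)) := by ring
      _ ≤ _ := h3
      _ = _ := by ring
  have hlim := (((hx n).1.mul ((tendsto_add_atTop_iff_nat 1).2 (hx n).1)).mul_const
    (α * (v n : ℝ) ^ 2 * (u n : ℝ) ^ 4))
  rw [zero_mul, zero_mul] at hlim
  exact absurd (ge_of_tendsto' hlim hbound) (not_le.2 (pow_pos hh 4))

end Growing

end DKdV

/-! ### The contracting carrier equation of the case `α = 0`. -/

namespace DKdV

open Lattice Filter Topology

section Contracting

variable {β : ℝ≥0}

theorem coe_map_zero_left_snd (β : ℝ≥0) (p : PosReal × PosReal) :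
    ((map 0 β p).2 : ℝ) = p.1 / (1 + β * p.1 * p.2) := by
  rw [coe_map_snd]
  simp

/-- `a` and `b` differ by a factor of at most `1 + s`. -/
def RatioLE (s a b : ℝ) : Prop := a ≤ (1 + s) * b ∧ b ≤ (1 + s) * a

theorem RatioLE.mono {s t a b : ℝ} (h : RatioLE s a b) (hst : s ≤ t) (ha : 0 ≤ a) (hb : 0 ≤ b) :
    RatioLE t a b :=
  ⟨h.1.trans (by gcongr), h.2.trans (by gcongr)⟩

theorem RatioLE.abs_sub_le {s a b c : ℝ} (h : RatioLE s a b) (hs : 0 ≤ s) (ha : a ≤ c)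
    (hb : b ≤ c) : |a - b| ≤ s * c := by
  have h1 := mul_le_mul_of_nonneg_left ha hs
  have h2 := mul_le_mul_of_nonneg_left hb hs
  obtain ⟨h3, h4⟩ := h
  rw [abs_sub_le_iff]
  constructor <;> linarith

/-- The ratio of the images is `(1 + q b) / (1 + q a) = 1 + q (b - a) / (1 + q a)`. If `b ≤ (1 + s)
a`, this is at most `1 + s * (q a / (1 + q a))`, and `q a ≤ t` bounds the last factor by `t / (1 +
t)`. -/
theorem RatioLE.step {s t q a b : ℝ} (h : RatioLE s a b) (hs : 0 ≤ s) (ha : 0 < a) (hb : 0 < b)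
    (hq : 0 < q) (hat : q * a ≤ t) (hbt : q * b ≤ t) {x : ℝ} (hx : 0 < x) :
    RatioLE (t / (1 + t) * s) (x / (1 + q * a)) (x / (1 + q * b)) := by
  have key : ∀ a b : ℝ, 0 < a → 0 < b → b ≤ (1 + s) * a → q * a ≤ t →
      x / (1 + q * a) ≤ (1 + t / (1 + t) * s) * (x / (1 + q * b)) := by
    intro a b ha hb hab hat
    have hqa : 0 < q * a := mul_pos hq ha
    have hqb : 0 < q * b := mul_pos hq hb
    have ht : 0 < 1 + t := by linarith
    rw [mul_div_assoc', div_le_div_iff₀ (by linarith) (by linarith), mul_comm (_ * x),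
      mul_comm x, ← mul_assoc]
    refine mul_le_mul_of_nonneg_right ?_ hx.le
    have h1 : q * a ≤ t / (1 + t) * (1 + q * a) := by
      rw [div_mul_eq_mul_div, le_div_iff₀ ht]
      nlinarith
    have h2 : q * b ≤ q * ((1 + s) * a) := mul_le_mul_of_nonneg_left hab hq.le
    have h3 := mul_le_mul_of_nonneg_left h1 hs
    nlinarith
  exact ⟨key a b ha hb h.2 hat, key b a hb ha h.1 hbt⟩

/-- The bound for the contraction of ratios when the carrier passes through position `m`. -/
noncomputable def contraction (β : ℝ) (x : ℤ → PosReal) (m : ℤ) : ℝ :=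
  β * x m * x (m - 1) / (1 + β * x m * x (m - 1))

theorem contraction_pos (hβ : 0 < β) (x : ℤ → PosReal) (m : ℤ) : 0 < contraction β x m := by
  have h1 : 0 < (x m : ℝ) := (x m).2
  have h2 : 0 < (x (m - 1) : ℝ) := (x (m - 1)).2
  have hβ' : (0 : ℝ) < β := hβ
  unfold contraction
  positivity

theorem contraction_le_one (hβ : 0 < β) (x : ℤ → PosReal) (m : ℤ) : contraction β x m ≤ 1 := by
  have h1 : 0 < (x m : ℝ) := (x m).2
  have h2 : 0 < (x (m - 1) : ℝ) := (x (m - 1)).2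
  have hβ' : (0 : ℝ) < β := hβ
  exact (div_le_one (by positivity)).2 (by linarith)

theorem contraction_le_half (hβ : 0 < β) {x : ℤ → PosReal} {m : ℤ}
    (h : (β * x m * x (m - 1) : ℝ) ≤ 1) : contraction β x m ≤ 1 / 2 := by
  have h1 : 0 < (x m : ℝ) := (x m).2
  have h2 : 0 < (x (m - 1) : ℝ) := (x (m - 1)).2
  have hβ' : (0 : ℝ) < β := hβ
  exact (div_le_div_iff₀ (by positivity) (by norm_num)).2 (by linarith)

/-- `u` solves the carrier equation to the right of position `a`. -/
def IsCarrierAfter (F : PosReal × PosReal → PosReal × PosReal) (x : ℤ → PosReal) (a : ℤ)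
    (u : ℤ → PosReal) : Prop :=
  ∀ n, a < n → (F (x n, u (n - 1))).2 = u n

theorem isCarrierAfter_carrierFrom (F : PosReal × PosReal → PosReal × PosReal) (x : ℤ → PosReal)
    (w : PosReal) (a : ℤ) :
    IsCarrierAfter F x a fun n => carrierFrom F x w a (n - a).toNat :=
  fun _ hn => (carrierFrom_toNat x w hn).symm

variable {x : ℤ → PosReal} {a : ℤ} {u u' : ℤ → PosReal}

theorem IsCarrierAfter.coe_eq (hu : IsCarrierAfter (map 0 β) x a u) {n : ℤ} (hn : a < n) :
    (u n : ℝ) = x n / (1 + β * x n * u (n - 1)) := by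
  rw [← hu n hn, coe_map_zero_left_snd]

theorem IsCarrierAfter.le (hu : IsCarrierAfter (map 0 β) x a u) {n : ℤ} (hn : a < n) :
    (u n : ℝ) ≤ x n := by
  have h1 : 0 < (x n : ℝ) := (x n).2
  have h2 : 0 < (u (n - 1) : ℝ) := (u (n - 1)).2
  rw [hu.coe_eq hn]
  exact div_le_self h1.le (le_add_of_nonneg_right (by positivity))

theorem IsCarrierAfter.ge (hu : IsCarrierAfter (map 0 β) x a u) {n : ℤ} (hn : a + 1 < n) :
    (x n : ℝ) / (1 + β * x n * x (n - 1)) ≤ u n := by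
  have h1 : 0 < (x n : ℝ) := (x n).2
  have h2 : 0 < (u (n - 1) : ℝ) := (u (n - 1)).2
  have h3 := hu.le (n := n - 1) (by omega)
  rw [hu.coe_eq (n := n) (by omega)]
  gcongr

theorem IsCarrierAfter.ratioLE (hu : IsCarrierAfter (map 0 β) x a u)
    (hu' : IsCarrierAfter (map 0 β) x a u') {n : ℤ} (hn : a + 1 < n) :
    RatioLE (β * x n * x (n - 1)) (u n) (u' n) := by
  have h1 : 0 < (x n : ℝ) := (x n).2
  have h2 : 0 < (x (n - 1) : ℝ) := (x (n - 1)).2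
  have h3 : (0 : ℝ) < 1 + β * x n * x (n - 1) := by positivity
  have h4 := hu.ge hn
  have h5 := hu'.ge hn
  rw [div_le_iff₀' h3] at h4 h5
  exact ⟨(hu.le (by omega)).trans h5, (hu'.le (by omega)).trans h4⟩

/-- Two steps after the start, the a priori bounds on a carrier already control ratios whatever the
starting values. This is the initial error at `n - k`, and each later site multiplies it by its
contraction factor. -/
theorem IsCarrierAfter.ratioLE_prod (hβ : 0 < β) (hu : IsCarrierAfter (map 0 β) x a u)
    (hu' : IsCarrierAfter (map 0 β) x a u') (n : ℤ) (k : ℕ) (hn : a + 1 < n - k) :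
    RatioLE ((∏ j ∈ Finset.range k, contraction β x (n - j))
      * (β * x (n - k) * x (n - k - 1))) (u n) (u' n) := by
  induction k generalizing n with
  | zero => simpa using hu.ratioLE hu' (n := n) (by simpa using hn)
  | succ k ih =>
    have h1 := ih (n - 1) (by push_cast at hn; omega)
    have h2 : (n - 1 - k : ℤ) = n - (k + 1 : ℕ) := by
      push_cast
      ring
    have h3 : ∀ j : ℕ, (n - 1 - j : ℤ) = n - (j + 1 : ℕ) := fun j => by
      push_cast
      ring
    rw [h2] at h1
    simp only [h3] at h1
    have hx : 0 < (x n : ℝ) := (x n).2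
    have hx1 : 0 < (x (n - (k + 1 : ℕ)) : ℝ) := (x _).2
    have hx2 : 0 < (x (n - (k + 1 : ℕ) - 1) : ℝ) := (x _).2
    have hβ' : (0 : ℝ) < β := hβ
    have hp : 0 < ∏ j ∈ Finset.range k, contraction β x (n - (j + 1 : ℕ)) :=
      Finset.prod_pos fun j _ => contraction_pos hβ x _
    have h4 := h1.step (by positivity) (u (n - 1)).2 (u' (n - 1)).2 (q := β * x n)
      (t := β * x n * x (n - 1)) (by positivity)
      (mul_le_mul_of_nonneg_left (hu.le (by push_cast at hn; omega)) (by positivity))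
      (mul_le_mul_of_nonneg_left (hu'.le (by push_cast at hn; omega)) (by positivity)) hx
    rw [← hu.coe_eq (by push_cast at hn; omega), ← hu'.coe_eq (by push_cast at hn; omega)] at h4
    convert h4 using 1
    rw [Finset.prod_range_succ', contraction]
    simp only [Nat.cast_zero, sub_zero]
    ring

/-- The configurations whose gains decay to the left. -/
def decayingConfigs (γ : ℝ≥0) : Set (ℤ → PosReal) :=
  {x | ∀ n, Tendsto (gain γ x n) atTop (𝓝 0)}

theorem frequently_mul_le_one (hβ : 0 < β) (hx : x ∈ decayingConfigs β) (n : ℤ) :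
    ∃ᶠ k : ℕ in atTop, (β * x (n - k) * x (n - k - 1) : ℝ) ≤ 1 := by
  have hβ' : (0 : ℝ) < β := hβ
  intro h
  obtain ⟨M, hM⟩ := eventually_atTop.1 h
  -- The gain over two neighbouring sites is the square of `β x_m x_(m-1)`. If these products all
  -- exceeded `1` far to the left, the gains would not decay.
  have hmono : ∀ i : ℕ, gain β x n M ≤ gain β x n (M + 2 * i) := by
    intro i
    induction i with
    | zero => rfl
    | succ i ih =>
      refine ih.trans ?_
      have h1 := not_le.1 (hM (M + 2 * i) (by omega))
      have h2 : (n - (M + 2 * i + 1 : ℕ) : ℤ) = n - (M + 2 * i : ℕ) - 1 := by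
        push_cast
        ring
      rw [show M + 2 * (i + 1) = M + 2 * i + 1 + 1 by ring, gain_succ, gain_succ, h2, mul_assoc]
      refine le_mul_of_one_le_right (gain_pos hβ' x n _).le ?_
      calc (1 : ℝ) ≤ (β * x (n - (M + 2 * i : ℕ)) * x (n - (M + 2 * i : ℕ) - 1)) ^ 2 :=
            one_le_pow₀ h1.le
        _ = _ := by ring
  have hlim : Tendsto (fun i : ℕ => gain β x n (M + 2 * i)) atTop (𝓝 0) :=
    (hx n).comp (tendsto_atTop_mono (fun i => show i ≤ M + 2 * i by omega) tendsto_id)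
  exact absurd (ge_of_tendsto' hlim hmono) (not_le.2 (gain_pos hβ' x n M))

theorem tendsto_prod_contraction (hβ : 0 < β) (hx : x ∈ decayingConfigs β) (n : ℤ) :
    Tendsto (fun k : ℕ => ∏ j ∈ Finset.range k, contraction β x (n - j)) atTop (𝓝 0) := by
  set D : ℕ → ℝ := fun k => ∏ j ∈ Finset.range k, contraction β x (n - j) with hD
  have hpos : ∀ k, 0 ≤ D k := fun k => Finset.prod_nonneg fun j _ => (contraction_pos hβ x _).le
  have hsucc : ∀ k, D (k + 1) = D k * contraction β x (n - k) := fun k =>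
    Finset.prod_range_succ _ _
  have hanti : Antitone D := antitone_nat_of_succ_le fun k => by
    rw [hsucc]
    exact mul_le_of_le_one_right (hpos k) (contraction_le_one hβ x _)
  obtain ⟨L, hL⟩ : ∃ L, Tendsto D atTop (𝓝 L) :=
    ⟨_, tendsto_atTop_ciInf hanti ⟨0, by rintro _ ⟨k, rfl⟩; exact hpos k⟩⟩
  have h0 : 0 ≤ L := ge_of_tendsto' hL hpos
  -- Infinitely many factors are at most `1 / 2`, so the limit satisfies `L ≤ L / 2`.
  have h1 : L - L * (1 / 2) ≤ 0 := by
    refine le_of_tendsto_of_frequently (((tendsto_add_atTop_iff_nat 1).2 hL).sub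
      (hL.mul_const (1 / 2))) ((frequently_mul_le_one hβ hx n).mono fun k hk => ?_)
    rw [hsucc, sub_nonpos]
    exact mul_le_mul_of_nonneg_left (contraction_le_half hβ hk) (hpos k)
  rwa [show L = 0 by linarith] at hL

theorem exists_ratioLE (hβ : 0 < β) (hx : x ∈ decayingConfigs β) (n : ℤ) {ε : ℝ} (hε : 0 < ε) :
    ∃ b < n, ∀ a ≤ b, ∀ u u' : ℤ → PosReal, IsCarrierAfter (map 0 β) x a u →
      IsCarrierAfter (map 0 β) x a u' → RatioLE ε (u n) (u' n) := by
  -- One `k` has to serve twice: the initial error at `n - k` is at most `1`, and the contraction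
  -- product is already below `ε`.
  obtain ⟨k, hk1, hk2⟩ := ((frequently_mul_le_one hβ hx n).and_eventually
    ((tendsto_prod_contraction hβ hx n).eventually_lt_const hε)).exists
  refine ⟨n - k - 2, by omega, fun a ha u u' hu hu' => ?_⟩
  refine (hu.ratioLE_prod hβ hu' n k (by omega)).mono ?_ (u n).2.le (u' n).2.le
  refine (mul_le_of_le_one_right ?_ hk1).trans hk2.le
  exact Finset.prod_nonneg fun j _ => (contraction_pos hβ x _).le

theorem IsCarrierAfter.mono {F : PosReal × PosReal → PosReal × PosReal} {b : ℤ}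
    (hu : IsCarrierAfter F x a u) (h : a ≤ b) : IsCarrierAfter F x b u :=
  fun n hn => hu n (h.trans_lt hn)

theorem exists_abs_sub_le (hβ : 0 < β) (hx : x ∈ decayingConfigs β) (n : ℤ) {ε : ℝ} (hε : 0 < ε) :
    ∃ b : ℤ, ∀ a ≤ b, ∀ u u' : ℤ → PosReal, IsCarrierAfter (map 0 β) x a u →
      IsCarrierAfter (map 0 β) x a u' → |(u n : ℝ) - u' n| < ε := by
  have hxn : 0 < (x n : ℝ) := (x n).2
  obtain ⟨b, hbn, hb⟩ := exists_ratioLE hβ hx n (ε := ε / (2 * x n)) (by positivity)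
  refine ⟨b, fun a ha u u' hu hu' => ?_⟩
  refine ((hb a ha u u' hu hu').abs_sub_le (by positivity) (hu.le (by omega))
    (hu'.le (by omega))).trans_lt ?_
  rw [div_mul_eq_mul_div, div_lt_iff₀ (by positivity)]
  nlinarith [mul_pos hε hxn]

theorem isCarrier_map_zero_left_unique (hβ : 0 < β) (hx : x ∈ decayingConfigs β)
    (hu : IsCarrier (map 0 β) x u) (hu' : IsCarrier (map 0 β) x u') : u = u' := by
  funext n
  refine Subtype.ext (eq_of_abs_sub_le_all fun ε hε => ?_)
  obtain ⟨b, hb⟩ := exists_abs_sub_le hβ hx n hε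
  exact (hb b le_rfl u u' (fun m _ => hu m) (fun m _ => hu' m)).le

theorem exists_tendsto_carrierFrom_map_zero_left (hβ : 0 < β) (hx : x ∈ decayingConfigs β) :
    ∃ u : ℤ → PosReal, ∀ (w : PosReal) (n : ℤ),
      Tendsto (fun N : ℕ => carrierFrom (map 0 β) x w (-N) (n + N).toNat) atTop (𝓝 (u n)) := by
  have hc : ∀ (w : PosReal) (N : ℕ), IsCarrierAfter (map 0 β) x (-N)
      fun n => carrierFrom (map 0 β) x w (-N) (n + N).toNat := fun w N => by
    simpa using isCarrierAfter_carrierFrom (map 0 β) x w (-N)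
  set c : PosReal → ℤ → ℕ → ℝ :=
    fun w n N => (carrierFrom (map 0 β) x w (-N) (n + N).toNat : PosReal) with hcdef
  have hclose : ∀ (n : ℤ) (ε : ℝ), 0 < ε → ∃ N₀ : ℕ, ∀ N ≥ N₀, ∀ N' ≥ N₀, ∀ w w',
      |c w n N - c w' n N'| < ε := fun n ε hε => by
    obtain ⟨b, hb⟩ := exists_abs_sub_le hβ hx n hε
    exact ⟨b.natAbs, fun N hN N' hN' w w' => hb (-(b.natAbs : ℤ)) (by omega) _ _
      ((hc w N).mono (by omega)) ((hc w' N').mono (by omega))⟩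
  have hex : ∀ n : ℤ, ∃ L : ℝ, ∀ w, Tendsto (c w n) atTop (𝓝 L) := fun n => by
    obtain ⟨L, hL⟩ := cauchySeq_tendsto_of_complete (u := c ⟨1, one_pos⟩ n)
      (Metric.cauchySeq_iff.2 fun ε hε => by
        obtain ⟨N₀, h⟩ := hclose n ε hε
        exact ⟨N₀, fun N hN N' hN' => h N hN N' hN' _ _⟩)
    refine ⟨L, fun w => ?_⟩
    have h1 : Tendsto (fun N => c w n N - c ⟨1, one_pos⟩ n N) atTop (𝓝 0) :=
      Metric.tendsto_atTop.2 fun ε hε => by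
        obtain ⟨N₀, h⟩ := hclose n ε hε
        exact ⟨N₀, fun N hN => by simpa [Real.dist_eq] using h N hN N hN _ _⟩
    simpa using h1.add hL
  choose L hL using hex
  -- The lower bound on carriers is uniform in the starting point, which keeps the limit away from
  -- `0`.
  have hpos : ∀ n, 0 < L n := fun n => by
    have h1 : 0 < (x n : ℝ) := (x n).2
    have h2 : 0 < (x (n - 1) : ℝ) := (x (n - 1)).2
    refine lt_of_lt_of_le (b := (x n : ℝ) / (1 + β * x n * x (n - 1))) (by positivity)
      (ge_of_tendsto (hL n ⟨1, one_pos⟩) ?_)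
    filter_upwards [eventually_ge_atTop (n.natAbs + 2)] with N hN
    exact (hc _ N).ge (n := n) (by omega)
  exact ⟨fun n => ⟨L n, hpos n⟩, fun w n => tendsto_subtype_rng.2 (hL n w)⟩

open Classical in
/-- The carrier for configurations whose gains decay to the left, in the contracting case. -/
noncomputable def limitCarrier (β : ℝ≥0) (x : ℤ → PosReal) : ℤ → PosReal :=
  if h : 0 < β ∧ x ∈ decayingConfigs β then
    (exists_tendsto_carrierFrom_map_zero_left h.1 h.2).choose
  else x

theorem tendsto_carrierFrom_limitCarrier (hβ : 0 < β) (hx : x ∈ decayingConfigs β) (w : PosReal)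
    (n : ℤ) : Tendsto (fun N : ℕ => carrierFrom (map 0 β) x w (-N) (n + N).toNat) atTop
      (𝓝 (limitCarrier β x n)) := by
  have h := (exists_tendsto_carrierFrom_map_zero_left hβ hx).choose_spec w n
  rwa [limitCarrier, dif_pos ⟨hβ, hx⟩]

theorem isCarrier_limitCarrier (hβ : 0 < β) (hx : x ∈ decayingConfigs β) :
    IsCarrier (map 0 β) x (limitCarrier β x) :=
  isCarrier_of_tendsto (continuous_map 0 β) (w := ⟨1, one_pos⟩)
    (tendsto_carrierFrom_limitCarrier hβ hx _)

theorem isSelection_limitCarrier (hβ : 0 < β) :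
    IsSelection (map 0 β) (decayingConfigs β) (limitCarrier β) :=
  ⟨fun _ hx => isCarrier_limitCarrier hβ hx, fun _ hx _ _ hu _ =>
    isCarrier_map_zero_left_unique hβ hx hu (isCarrier_limitCarrier hβ hx)⟩

theorem decayingConfigs_subset_uniqueCarrier (hβ : 0 < β) :
    decayingConfigs β ⊆ uniqueCarrier (map 0 β) := fun _ hx =>
  ⟨_, isCarrier_limitCarrier hβ hx, fun _ hu =>
    isCarrier_map_zero_left_unique hβ hx hu (isCarrier_limitCarrier hβ hx)⟩

end Contracting

end DKdV

/-! ### Almost sure decay of the gains. -/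

namespace DKdV

open Lattice Filter Topology ProbabilityTheory

/-- Since `|log x| ≤ (2 / l) (x^(l/2) + x^(-l/2))`, the integrand is dominated by a combination of
the densities with parameters `l / 2` and `3 l / 2`, both still positive. -/
theorem integrable_log_gig {l c₁ c₂ : ℝ} (hl : 0 < l) (hc₁ : 0 ≤ c₁) (hc₂ : 0 < c₂) :
    Integrable (fun x : PosReal => Real.log x) (gig l c₁ c₂) := by
  have hprob := isProbabilityMeasure_gig hl hc₁ hc₂
  have hne : densityMeasure (fun x => x ^ (-l - 1) * Real.exp (-c₁ * x - c₂ * x⁻¹))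
      Set.univ ≠ 0 := by
    intro h
    rw [gig, normalizedDensity, Measure.measure_univ_eq_zero.1 h] at hprob
    simpa using hprob.measure_univ
  refine Integrable.smul_measure ?_ (ENNReal.inv_ne_top.2 hne)
  set w : ℝ → ℝ := fun x => x ^ (-l - 1) * Real.exp (-c₁ * x - c₂ * x⁻¹) with hw
  have hwm : Measurable w := by fun_prop
  rw [densityMeasure, integrable_withDensity_iff_integrable_smul₀' (by fun_prop) (by simp)]
  have hS : MeasurableSet {x : ℝ | 0 < x} := measurableSet_Ioi
  have hdom : ∀ s : ℝ, 0 < s → IntegrableOn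
      (fun x : ℝ => x ^ (-s - 1) * Real.exp (-c₁ * x - c₂ * x⁻¹)) (Set.Ioi 0) := fun s hs =>
    integrableOn_gig hs hc₁ hc₂
  have hint : IntegrableOn (fun x : ℝ => w x * Real.log x) (Set.Ioi 0) := by
    refine (((hdom (l / 2) (by positivity)).add (hdom (3 * l / 2) (by positivity))).const_mul
      (2 / l)).mono' (by fun_prop) ?_
    refine (ae_restrict_iff' measurableSet_Ioi).2 (.of_forall fun x hx => ?_)
    have hx : 0 < x := hx
    have hlog : |Real.log x| ≤ 2 / l * (x ^ (l / 2) + x ^ (-(l / 2))) := by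
      have h1 := Real.log_le_rpow_div hx.le (half_pos hl)
      have h2 := Real.log_le_rpow_div (inv_pos.2 hx).le (half_pos hl)
      rw [Real.log_inv, Real.inv_rpow hx.le, ← Real.rpow_neg hx.le] at h2
      have h3 : ∀ a : ℝ, a / (l / 2) = 2 / l * a := fun a => by
        field_simp
      rw [h3] at h1 h2
      have h4 : 0 ≤ 2 / l * x ^ (l / 2) := by positivity
      have h5 : 0 ≤ 2 / l * x ^ (-(l / 2)) := by positivity
      rw [abs_le]
      constructor <;> linarith
    have hw0 : 0 ≤ w x := by positivity
    rw [Real.norm_eq_abs, abs_mul, abs_of_nonneg hw0]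
    refine (mul_le_mul_of_nonneg_left hlog hw0).trans_eq ?_
    have e1 : x ^ (-(l / 2) - 1) = x ^ (-l - 1) * x ^ (l / 2) := by
      rw [← Real.rpow_add hx]
      ring_nf
    have e2 : x ^ (-(3 * l / 2) - 1) = x ^ (-l - 1) * x ^ (-(l / 2)) := by
      rw [← Real.rpow_add hx]
      ring_nf
    simp only [hw, Pi.add_apply, e1, e2]
    ring
  have hemb : MeasurableEmbedding (Subtype.val : PosReal → ℝ) := .subtype_coe hS
  have hmap := hemb.integrable_map_iff
    (μ := (volume : Measure ℝ).comap (Subtype.val : PosReal → ℝ))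
    (g := fun x : ℝ => w x * Real.log x)
  have hrange : Set.range (Subtype.val : PosReal → ℝ) = Set.Ioi 0 := Subtype.range_coe
  rw [hemb.map_comap, hrange] at hmap
  refine (hmap.1 hint).congr (.of_forall fun x => ?_)
  have hx : 0 < (x : ℝ) := x.2
  have hw0 : 0 ≤ w x := by positivity
  simp [ENNReal.toReal_ofReal hw0]

/-- The strong law of large numbers for the gains. -/
theorem tendsto_log_gain {μ : Measure PosReal} [IsProbabilityMeasure μ]
    (hμ : Integrable (fun x : PosReal => Real.log x) μ) {γ : ℝ} (hγ : 0 < γ) (n : ℤ) :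
    ∀ᵐ x ∂iidMeasure μ, Tendsto (fun k : ℕ => Real.log (gain γ x n k) / k) atTop
      (𝓝 (Real.log γ + 2 * ∫ x : PosReal, Real.log x ∂μ)) := by
  set f : PosReal → ℝ := fun x => Real.log γ + 2 * Real.log x with hf
  have hfm : Measurable f := by fun_prop
  have hfi : Integrable f μ := (integrable_const _).add (hμ.const_mul 2)
  have hev : ∀ m : ℤ, MeasurePreserving (fun x : ℤ → PosReal => x m) (iidMeasure μ) μ := fun m =>
    measurePreserving_eval_infinitePi (fun _ : ℤ => μ) m
  have hlaw := strong_law_ae_real (μ := iidMeasure μ)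
    (fun (j : ℕ) (x : ℤ → PosReal) => f (x (n - j)))
    (((hev (n - (0 : ℕ))).integrable_comp hfi.aestronglyMeasurable).2 hfi)
    (fun i j hij => (iIndepFun_infinitePi (P := fun _ : ℤ => μ) (X := fun _ => f)
      (fun _ => hfm)).indepFun (i := n - i) (j := n - j) (by simpa using hij))
    (fun i => by
      refine ⟨(hfm.comp (hev _).measurable).aemeasurable,
        (hfm.comp (hev _).measurable).aemeasurable, ?_⟩
      have h1 : ∀ m : ℤ, (iidMeasure μ).map (fun x : ℤ → PosReal => f (x m)) = μ.map f := fun m =>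
        (Measure.map_map hfm (hev m).measurable).symm.trans (congrArg _ (hev m).map_eq)
      rw [h1, h1])
  have hmean : ∫ x : ℤ → PosReal, f (x (n - (0 : ℕ))) ∂iidMeasure μ
      = Real.log γ + 2 * ∫ x : PosReal, Real.log x ∂μ := by
    have h1 := integral_map (μ := iidMeasure μ) (hev (n - (0 : ℕ))).measurable.aemeasurable
      (f := f) hfm.aestronglyMeasurable
    rw [(hev _).map_eq] at h1
    rw [← h1, hf, integral_add (integrable_const _) (hμ.const_mul 2), integral_const_mul]
    simp
  rw [hmean] at hlaw
  filter_upwards [hlaw] with x hx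
  refine hx.congr fun k => ?_
  have hne : ∀ j ∈ Finset.range k, γ * (x (n - j) : ℝ) ^ 2 ≠ 0 := fun j _ =>
    (mul_pos hγ (pow_pos (x (n - j)).2 2)).ne'
  rw [gain, Real.log_prod hne]
  congr 1
  refine Finset.sum_congr rfl fun j _ => ?_
  rw [Real.log_mul hγ.ne' (pow_pos (x (n - j)).2 2).ne', Real.log_pow]
  simp [hf]

theorem mem_summableConfigs_of_tendsto {γ : ℝ≥0} (hγ : 0 < γ) {x : ℤ → PosReal} {r : ℝ}
    (hr : r < 0) (h : ∀ n, Tendsto (fun k : ℕ => Real.log (gain γ x n k) / k) atTop (𝓝 r)) :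
    x ∈ summableConfigs γ := by
  intro n
  have hγ' : (0 : ℝ) < γ := hγ
  -- Half the limiting rate leaves room: eventually `gain ≤ q ^ k` with `q < 1`.
  set q : ℝ := Real.exp (r / 2) with hq
  have hq0 : 0 < q := Real.exp_pos _
  have hq1 : q < 1 := Real.exp_lt_one_iff.2 (by linarith)
  have hle : ∀ᶠ k in atTop, gain γ x n k ≤ q ^ k := by
    filter_upwards [(h n).eventually_lt_const (show r < r / 2 by linarith),
      eventually_gt_atTop 0] with k hk hk0
    have hk0' : (0 : ℝ) < k := Nat.cast_pos.2 hk0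
    rw [div_lt_iff₀ hk0'] at hk
    rw [hq, ← Real.exp_nat_mul, ← Real.log_le_iff_le_exp (gain_pos hγ' x n k), mul_comm]
    exact hk.le
  refine ⟨squeeze_zero' (.of_forall fun k => (gain_pos hγ' x n k).le) hle
    (tendsto_pow_atTop_nhds_zero_of_lt_one hq0.le hq1), ?_⟩
  -- By `mul_carrierTerm_sq` a term is the geometric mean of two consecutive gains divided by `√γ`.
  refine Summable.of_norm_bounded_eventually_nat
    ((summable_geometric_of_lt_one hq0.le hq1).mul_left (1 / √γ)) ?_
  filter_upwards [hle, (tendsto_add_atTop_nat 1).eventually hle] with k h1 h2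
  have hpos := carrierTerm_pos hγ' x n k
  rw [Real.norm_of_nonneg hpos.le, div_mul_eq_mul_div, one_mul, le_div_iff₀ (by positivity)]
  refine le_of_sq_le_sq ?_ (by positivity)
  rw [mul_pow, Real.sq_sqrt hγ'.le, mul_comm, mul_carrierTerm_sq, sq]
  exact mul_le_mul h1 (h2.trans (pow_le_pow_of_le_one hq0.le hq1.le (Nat.le_succ k)))
    (gain_pos hγ' x n _).le (by positivity)

theorem ae_mem_summableConfigs {l c₁ c₂ : ℝ} (hl : 0 < l) (hc₁ : 0 ≤ c₁) (hc₂ : 0 < c₂)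
    {γ : ℝ≥0} (hγ : 0 < γ)
    (h : 2 * ∫ x : PosReal, Real.log x ∂(gig l c₁ c₂) < -Real.log γ) :
    ∀ᵐ x ∂iidMeasure (gig l c₁ c₂), x ∈ summableConfigs γ := by
  have hprob := isProbabilityMeasure_gig hl hc₁ hc₂
  filter_upwards [ae_all_iff.2 (tendsto_log_gain (integrable_log_gig hl hc₁ hc₂)
    (NNReal.coe_pos.2 hγ))] with x hx
  exact mem_summableConfigs_of_tendsto hγ (by linarith) hx

end DKdV

theorem theorem3p12 (α β : ℝ≥0) :
    (α = β → ∀ μ : Measure DKdV.PosReal, IsProbabilityMeasure μ →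
      Lattice.IsInvariantOn (DKdV.map α β) (Lattice.uniqueSolution (DKdV.map α β))
        (iidMeasure μ)) ∧
    (0 < α → β = 0 → ∀ l c : ℝ, 0 < l → 0 < c →
      2 * ∫ x : DKdV.PosReal, Real.log x ∂(DKdV.gig l (c * α) c) < -Real.log α →
      Lattice.IsInvariantOn (DKdV.map α β) (Lattice.uniqueSolution (DKdV.map α β))
        (iidMeasure (DKdV.gig l (c * α) c))) ∧
    (α = 0 → 0 < β → ∀ l c : ℝ, 0 < l → 0 < c →
      2 * ∫ x : DKdV.PosReal, Real.log x ∂(DKdV.inverseGamma l c) < -Real.log β →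
      Lattice.IsInvariantOn (DKdV.map α β)
        (Lattice.uniqueSolution (DKdV.map α β) ∩ Lattice.uniqueCarrier (DKdV.map α β))
        (iidMeasure (DKdV.inverseGamma l c))) := by
  refine ⟨?_, ?_, ?_⟩
  · rintro rfl μ hμ
    rw [DKdV.map_self]
    exact Lattice.isInvariantOn_swap μ
  · rintro hα rfl l c hl hc h
    have hcα : 0 ≤ c * α := by positivity
    have h1 := DKdV.isProbabilityMeasure_gig hl hcα hc
    have h2 := DKdV.isProbabilityMeasure_inverseGamma hl hc
    have hmem := DKdV.ae_mem_summableConfigs hl hcα hc hα h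
    exact (DKdV.isSelection_minimalCarrier hα).isInvariantOn (DKdV.involutive_map α 0)
      (DKdV.continuous_map α 0) (DKdV.measurePreserving_map_gig_inverseGamma α hl hc) hmem
      (hmem.mono fun _ hx w n => DKdV.tendsto_carrierFrom_minimalCarrier hx w n)
  · rintro rfl hβ l c hl hc h
    have h1 := DKdV.isProbabilityMeasure_gig hl (c₁ := c * β) (by positivity) hc
    have h2 := DKdV.isProbabilityMeasure_inverseGamma hl hc
    have hmem : ∀ᵐ x ∂iidMeasure (DKdV.inverseGamma l c), x ∈ DKdV.decayingConfigs β := by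
      -- The inverse gamma law is the boundary case `c₁ = 0`, so the same strong law applies; only
      -- the decay of the gains is needed here.
      rw [DKdV.inverseGamma_eq_gig] at h ⊢
      exact (DKdV.ae_mem_summableConfigs hl le_rfl hc hβ h).mono fun _ hx n => (hx n).1
    exact ((DKdV.isSelection_limitCarrier hβ).isInvariantOn (DKdV.involutive_map 0 β)
      (DKdV.continuous_map 0 β) (DKdV.measurePreserving_map_inverseGamma_gig β hl hc) hmem
      (hmem.mono fun _ hx w n => DKdV.tendsto_carrierFrom_limitCarrier hβ hx w n)).inter
      (hmem.mono fun _ hx => DKdV.decayingConfigs_subset_uniqueCarrier hβ hx)
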